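/- Let $\mathbb V=\{0,1\}^\star$ be the set of finite 0-1 words, with prefix order $\le$, word length $|u|$ and root $\emptyset$, and let $\partial\mathbb V=\{0,1\}^\infty$, with the metric $d(u,v)=2^{-|u\wedge v|}$ for $u\neq v$, where $u\wedge v$ is the longest common prefix. For $u\in\mathbb V$ let $A_u\subset\partial\mathbb V$ be the set of infinite words with prefix $u$, and let $\lambda$ be the probability measure on $\partial\mathbb V$ with $\lambda(A_u)=2^{-|u|}$. A binary tree is a finite non-empty prefix-stable set $x\subset\mathbb V$; its external nodes are the children of nodes of $x$ that do not belong to $x$, $x(u)=\{v: uv\in x\}$ is its subtree rooted at $u$, and $B_x(u)=\min\{k:(u_1,\dots,u_k)\notin x\}$, $u\in\partial\mathbb V$, is its boundary function. The binary search tree chain $(X_n)_{n\ge1}$ is the Markov chain on the set of binary trees with $X_1=\{\emptyset\}$ for which $X_{n+1}$ is obtained from $X_n$ by adding one of the $n+1$ external nodes of $X_n$, chosen uniformly at random. Its Doob–Martin limit $X_\infty$ is the random probability measure on $\partial\mathbb V$ such that, with probability 1, $\#X_n(u)/\#X_n\to X_\infty(A_u)$ as $n\to\infty$ for all $u\in\mathbb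 V$. Let $H(n)=\sum_{k=1}^n 1/k$. Write $v\prec u$ for the strict lexicographic order on $\partial\mathbb V$, and let $$Y_n(u)=\int_{v\prec u}\bigl(B_{X_n}(v)-H(n)\bigr)\,\lambda(dv),\qquad u\in\partial\mathbb V.$$ Put $\xi_u=X_\infty(A_{u0})/X_\infty(A_u)$ and $C(t)=1+\tfrac12\bigl(\log t+\log(1-t)\bigr)$ for $0<t<1$, and for $u\in\mathbb V$ let $$L_\infty(u)=\sum_{v\ge u}2^{-|v|}C(\xi_v)=\lim_{k\to\infty}\sum_{v\ge u,\,|v|<k}2^{-|v|}C(\xi_v).$$ For $u=(u_k)_{k\ge1}\in\partial\mathbb V$ let $K(u)=\{k\ge 1:u_k=1\}$ and $u(k)=(u_1,\dots,u_{k-1},0)$ for $k\in K(u)$, and let $$Y'_\infty(u)=\sum_{k\in K(u)}L_\infty(u(k)),\qquad Y''_\infty(u)=\sum_{k\in K(u)}2^{-k}\bigl(k+\log X_\infty(A_{u(k)})\bigr).$$ Theorem. The limit $X_\infty$ exists. With probability 1 the following hold: $X_\infty(A_u)>0$ and the limit defining $L_\infty(u)$ exists for all $u\in\mathbb V$; both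 series $Y'_\infty(u)$ and $Y''_\infty(u)$ converge for all $u\in\partial\mathbb V$, and $Y'_\infty$ and $Y''_\infty$ are continuous functions on $\partial\mathbb V$. Moreover, $Y_\infty:=Y'_\infty+Y''_\infty$ is (up to modification on a null set) a random element of the Banach space $C(\partial\mathbb V)$ with the supremum norm, each $Y_n$ takes its values in $C(\partial\mathbb V)$, and, with probability 1, $$\lim_{n\to\infty}\|Y_n-Y_\infty\|_\infty=0.$$ -/

import Mathlib

open MeasureTheory Filter Topology

/-! ### Words, ends of the complete binary tree, cylinder sets -/

/-- Nodes of the complete binary tree: finite words `u = (u₁, …, u_k)`, with `false = 0`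
and `true = 1`. -/
abbrev Node := List Bool

/-- Infinite words, with the product topology (which is induced by the metric
`d(u, v) = 2 ^ (-|u ∧ v|)`) and the product σ-field.  The coordinate `u_k`, `k ≥ 1`, is `u (k - 1)`. -/
abbrev Ends := ℕ → Bool

/-- The prefix `(u₁, …, u_k)` of an infinite word. -/
def Ends.pre (u : Ends) (k : ℕ) : Node := List.ofFn (fun i : Fin k => u i)

/-- `A_u`, the set of infinite words with prefix `u`. -/
def Node.cyl (u : Node) : Set Ends := {v | Ends.pre v u.length = u}

/-- The strict lexicographic order on infinite words. -/
def Ends.Prec (u v : Ends) : Prop :=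
  ∃ l : ℕ, (∀ j < l, u j = v j) ∧ u l = false ∧ v l = true

/-- The law of a sequence of fair coin tosses; it satisfies `λ(A_u) = 2 ^ (-|u|)`,
see `coinMeasure_cyl`. -/
noncomputable def coinMeasure : Measure Ends :=
  Measure.infinitePi (fun _ : ℕ => (PMF.uniformOfFintype Bool).toMeasure)

instance : IsProbabilityMeasure coinMeasure := by
  unfold coinMeasure; infer_instance

/-! ### Binary trees -/

/-- A (finite, non-empty) binary tree: a prefix-stable finite set of nodes. -/
@[ext]
structure BinTree where
  nodes : Finset Node
  nonempty : nodes.Nonempty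
  prefix_mem : ∀ u ∈ nodes, ∀ v : Node, v <+: u → v ∈ nodes

namespace BinTree

instance : MeasurableSpace BinTree := ⊤

/-- The tree that consists of the root node only. -/
def root : BinTree where
  nodes := {[]}
  nonempty := ⟨[], by simp⟩
  prefix_mem := by
    intro u hu v hv
    rw [Finset.mem_singleton] at hu
    subst hu
    simpa using hv

/-- The external nodes of `x`: the children of nodes of `x` that are not nodes of `x`. -/
def external (x : BinTree) : Finset Node :=
  (x.nodes.image (fun u => u ++ [false]) ∪ x.nodes.image (fun u => u ++ [true])) \ x.nodes

/-- The fringe subtree `x(u) = {v : u + v ∈ x}`, as a (possibly empty) set of nodes. -/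
noncomputable def fringe (x : BinTree) (u : Node) : Finset Node :=
  x.nodes.preimage (fun v => u ++ v) (List.append_right_injective u).injOn

open Classical in
/-- Transition probabilities of the binary search tree chain: one of the external nodes is
chosen uniformly at random and incorporated into the tree. -/
noncomputable def trans (x y : BinTree) : ENNReal :=
  if ∃ u ∈ x.external, y.nodes = insert u x.nodes then (x.external.card : ENNReal)⁻¹ else 0

/-- The boundary function `B_x(u) = min {k : (u₁, …, u_k) ∉ x}`. -/
noncomputable def bdry (x : BinTree) (u : Ends) : ℕ := sInf {k | u.pre k ∉ x.nodes}

/-- The smoothed, centred boundary function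
`u ↦ ∫_{v ≺ u} (B_x(v) - H(n)) λ(dv)`, where `H(n)` is the `n`th harmonic number. -/
noncomputable def smoothBdryFun (x : BinTree) (n : ℕ) (u : Ends) : ℝ :=
  ∫ v in {v : Ends | v.Prec u}, ((x.bdry v : ℝ) - (harmonic n : ℝ)) ∂coinMeasure

end BinTree

/-! ### The binary search tree chain and its Doob–Martin limit -/

/-- `X₁, X₂, …` is a version of the binary search tree chain under `P` (the value `X 0` plays
no role): a Markov chain that starts with the one-node tree and has transition
probabilities `BinTree.trans`. -/
structure IsBSTChain {Ω : Type*} [MeasurableSpace Ω] (P : Measure Ω) (X : ℕ → Ω → BinTree) :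
    Prop where
  measurable : ∀ n, 1 ≤ n → Measurable (X n)
  start : ∀ᵐ ω ∂P, X 1 ω = BinTree.root
  markov : ∀ n, 1 ≤ n → ∀ x : ℕ → BinTree,
    P {ω | ∀ i ∈ Finset.Icc 1 (n + 1), X i ω = x i} =
      P {ω | ∀ i ∈ Finset.Icc 1 n, X i ω = x i} * BinTree.trans (x n) (x (n + 1))

/-- Convergence of a sequence of binary trees to a boundary point in the Doob–Martin
compactification: the boundary consists of the probability measures `ν` on the set of infinite
words, and convergence means that `#xₙ → ∞` and `#xₙ(u) / #xₙ → ν(A_u)` for all nodes `u`. -/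
def DoobMartinConv (x : ℕ → BinTree) (ν : ProbabilityMeasure Ends) : Prop :=
  Tendsto (fun n => (x n).nodes.card) atTop atTop ∧
    ∀ u : Node, Tendsto (fun n => (((x n).fringe u).card : ℝ) / ((x n).nodes.card : ℝ)) atTop
      (𝓝 ((ν : Measure Ends).real u.cyl))

open Classical in
/-- The Doob–Martin limit of a sequence of binary trees
(with the coin tossing measure as default value if the sequence does not converge). -/
noncomputable def doobMartinLimit (x : ℕ → BinTree) : ProbabilityMeasure Ends :=
  if h : ∃ ν, DoobMartinConv x ν then h.choose else ⟨coinMeasure, inferInstance⟩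

/-! ### The limit function, for a given boundary point `ν` -/

/-- `ξ_u = ν(A_{u0}) / ν(A_u)`. -/
noncomputable def splitRatio (ν : ProbabilityMeasure Ends) (u : Node) : ℝ :=
  (ν : Measure Ends).real (Node.cyl (u ++ [false])) / (ν : Measure Ends).real (Node.cyl u)

/-- `C(t) = 1 + (log t + log (1 - t)) / 2`. -/
noncomputable def costC (t : ℝ) : ℝ := 1 + (1 / 2) * (Real.log t + Real.log (1 - t))

/-- The sum of `2 ^ (-|v|) C(ξ_v)` over the nodes `v = u + w`, `|w| < k`. -/
noncomputable def partialL (ν : ProbabilityMeasure Ends) (u : Node) (k : ℕ) : ℝ :=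
  ∑ i ∈ Finset.range k, ∑ w : Fin i → Bool,
    (2 : ℝ)⁻¹ ^ (u.length + i) * costC (splitRatio ν (u ++ List.ofFn w))

/-- `L_∞(u) = ∑_{v ≥ u} 2 ^ (-|v|) C(ξ_v)`, where `≥` is the prefix order and the (only
conditionally convergent) series is summed level by level. -/
noncomputable def limitL (ν : ProbabilityMeasure Ends) (u : Node) : ℝ :=
  limUnder atTop (partialL ν u)

/-- With `k = j + 1`, the summand `L_∞(u(k)) 1(u_k = 1)`, `u(k) = (u₁, …, u_{k-1}, 0)`,
of the series `Y'_∞(u)`. -/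
noncomputable def termY' (ν : ProbabilityMeasure Ends) (u : Ends) (j : ℕ) : ℝ :=
  if u j = true then limitL ν (u.pre j ++ [false]) else 0

/-- With `k = j + 1`, the summand `2 ^ (-k) (k + log ν(A_{u(k)})) 1(u_k = 1)`,
`u(k) = (u₁, …, u_{k-1}, 0)`, of the series `Y''_∞(u)`. -/
noncomputable def termY'' (ν : ProbabilityMeasure Ends) (u : Ends) (j : ℕ) : ℝ :=
  if u j = true then
    (2 : ℝ)⁻¹ ^ (j + 1) *
      (((j + 1 : ℕ) : ℝ) + Real.log ((ν : Measure Ends).real (Node.cyl (u.pre j ++ [false]))))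
  else 0

/-- `Y'_∞(u) = ∑_{k : u_k = 1} L_∞(u(k))`. -/
noncomputable def limitY' (ν : ProbabilityMeasure Ends) (u : Ends) : ℝ := ∑' j, termY' ν u j

/-- `Y''_∞(u) = ∑_{k : u_k = 1} 2 ^ (-k) (k + log ν(A_{u(k)}))`. -/
noncomputable def limitY'' (ν : ProbabilityMeasure Ends) (u : Ends) : ℝ := ∑' j, termY'' ν u j

/-! ### The smoothed boundary functions are continuous -/

theorem Ends.length_pre (u : Ends) (k : ℕ) : (u.pre k).length = k := by
  simp [Ends.pre]

theorem Ends.pre_eq_pre_iff (u v : Ends) (k : ℕ) :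
    u.pre k = v.pre k ↔ ∀ j < k, u j = v j := by
  unfold Ends.pre
  rw [List.ofFn_inj]
  constructor
  · intro h j hj
    exact congrFun h ⟨j, hj⟩
  · intro h
    funext i
    exact h i i.2

theorem coinMeasure_cyl_pre (v : Ends) (k : ℕ) :
    coinMeasure {w | w.pre k = v.pre k} = (2 : ENNReal)⁻¹ ^ k := by
  have h : {w : Ends | w.pre k = v.pre k} =
      Set.pi (Finset.range k : Set ℕ) (fun j => {v j}) := by
    ext w
    simp [Ends.pre_eq_pre_iff]
  rw [h, coinMeasure, Measure.infinitePi_pi _ (fun i _ => measurableSet_singleton _)]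
  simp

theorem coinMeasure_cyl (u : Node) : coinMeasure u.cyl = (2 : ENNReal)⁻¹ ^ u.length := by
  obtain ⟨v, hv⟩ : ∃ v : Ends, v.pre u.length = u := by
    refine ⟨fun i => u.getD i false, ?_⟩
    apply List.ext_getElem
    · simp [Ends.pre]
    · intro i h1 h2
      simp [Ends.pre]
  have := coinMeasure_cyl_pre v u.length
  rw [hv] at this
  exact this

theorem coinMeasure_singleton (v : Ends) : coinMeasure {v} = 0 := by
  have h : ∀ k : ℕ, coinMeasure {v} ≤ (2 : ENNReal)⁻¹ ^ k := by
    intro k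
    rw [← coinMeasure_cyl_pre v k]
    apply measure_mono
    rintro w rfl
    rfl
  have h2 : Tendsto (fun k : ℕ => (2 : ENNReal)⁻¹ ^ k) atTop (𝓝 0) :=
    ENNReal.tendsto_pow_atTop_nhds_zero_of_lt_one (by simp)
  exact le_antisymm (ge_of_tendsto' h2 h) bot_le

theorem Ends.continuous_pre (k : ℕ) :
    @Continuous Ends Node _ ⊥ (fun u => Ends.pre u k) := by
  let _ : TopologicalSpace Node := ⊥
  have _ : DiscreteTopology Node := ⟨rfl⟩
  have h : Continuous (fun u : Ends => fun i : Fin k => u i) := by fun_prop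
  exact (continuous_of_discreteTopology (f := fun f : Fin k → Bool => List.ofFn f)).comp h

theorem Ends.isClopen_pre (k : ℕ) (s : Set Node) : IsClopen {u : Ends | u.pre k ∈ s} := by
  let _ : TopologicalSpace Node := ⊥
  have _ : DiscreteTopology Node := ⟨rfl⟩
  exact (isClopen_discrete s).preimage (Ends.continuous_pre k)

theorem BinTree.exists_bound (x : BinTree) : ∃ N : ℕ, ∀ u : Ends, u.pre N ∉ x.nodes := by
  refine ⟨x.nodes.sup List.length + 1, fun u hu => ?_⟩
  have h := Finset.le_sup (f := List.length) hu
  rw [Ends.length_pre] at h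
  omega

theorem BinTree.measurable_bdry (x : BinTree) : Measurable x.bdry := by
  obtain ⟨N, hN⟩ := x.exists_bound
  refine measurable_to_countable' fun k => ?_
  have h : x.bdry ⁻¹' {k} =
      {u : Ends | u.pre k ∈ {w | w ∉ x.nodes}} ∩
        ⋂ j ∈ Finset.range k, {u : Ends | u.pre j ∈ {w | w ∈ x.nodes}} := by
    ext u
    simp only [Set.mem_preimage, Set.mem_singleton_iff, Set.mem_inter_iff, Set.mem_ofPred_eq,
      Set.mem_iInter, Finset.mem_range, BinTree.bdry]
    constructor
    · rintro rfl
      refine ⟨Nat.sInf_mem (s := {k | u.pre k ∉ x.nodes}) ⟨N, hN u⟩, fun j hj => ?_⟩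
      by_contra hc
      exact absurd (Nat.sInf_le (s := {k | u.pre k ∉ x.nodes}) hc) (not_le.2 hj)
    · rintro ⟨h1, h2⟩
      refine le_antisymm (Nat.sInf_le (s := {k | u.pre k ∉ x.nodes}) h1) ?_
      by_contra hc
      exact Nat.sInf_mem (s := {k | u.pre k ∉ x.nodes}) ⟨N, hN u⟩ (h2 _ (not_le.1 hc))
  rw [h]
  exact (Ends.isClopen_pre _ _).isOpen.measurableSet.inter
    (Finset.measurableSet_biInter _ fun j _ => (Ends.isClopen_pre _ _).isOpen.measurableSet)

theorem Ends.measurableSet_prec (u : Ends) : MeasurableSet {v : Ends | v.Prec u} := by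
  have h : {v : Ends | v.Prec u} = ⋃ l : ℕ, ⋃ _ : u l = true,
      {v : Ends | v.pre l ∈ ({u.pre l} : Set Node)} ∩ {v : Ends | v l = false} := by
    ext v
    simp only [Ends.Prec, Set.mem_ofPred_eq, Set.mem_iUnion, Set.mem_inter_iff,
      Set.mem_singleton_iff, Ends.pre_eq_pre_iff, exists_prop]
    constructor
    · rintro ⟨l, h1, h2, h3⟩
      exact ⟨l, h3, h1, h2⟩
    · rintro ⟨l, h3, h1, h2⟩
      exact ⟨l, h1, h2, h3⟩
  rw [h]
  refine MeasurableSet.iUnion fun l => MeasurableSet.iUnion fun _ =>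
    (Ends.isClopen_pre _ _).isOpen.measurableSet.inter ?_
  exact (measurable_pi_apply (X := fun _ : ℕ => Bool) l) (MeasurableSet.singleton false)

theorem Ends.eventually_prec_iff {u v : Ends} (h : v ≠ u) :
    ∀ᶠ w in 𝓝 u, (v.Prec w ↔ v.Prec u) := by
  obtain ⟨m, hm⟩ := Function.ne_iff.1 h
  have hopen : {w : Ends | w.pre (m + 1) ∈ ({u.pre (m + 1)} : Set Node)} ∈ 𝓝 u :=
    (Ends.isClopen_pre _ _).isOpen.mem_nhds rfl
  have key : ∀ a b : Ends, (∀ j < m + 1, a j = b j) → v m ≠ a m → v.Prec a → v.Prec b := by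
    rintro a b hab hne ⟨l, h1, h2, h3⟩
    have hl : l < m + 1 := by
      by_contra hc
      exact hne (h1 m (by omega))
    exact ⟨l, fun j hj => (h1 j hj).trans (hab j (by omega)), h2, (hab l hl) ▸ h3⟩
  filter_upwards [hopen] with w hw
  have hw' := (Ends.pre_eq_pre_iff _ _ _).1 hw
  constructor
  · exact key w u hw' (by rw [hw' m (by omega)]; exact hm)
  · exact key u w (fun j hj => (hw' j hj).symm) hm

theorem BinTree.continuous_smoothBdryFun (x : BinTree) (n : ℕ) :
    Continuous (x.smoothBdryFun n) := by
  obtain ⟨N, hN⟩ := x.exists_bound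
  have hmeas : Measurable (fun v : Ends => (x.bdry v : ℝ) - (harmonic n : ℝ)) :=
    (measurable_from_top.comp x.measurable_bdry).sub_const _
  have heq : x.smoothBdryFun n = fun u => ∫ v, Set.indicator {v : Ends | v.Prec u}
      (fun v => (x.bdry v : ℝ) - (harmonic n : ℝ)) v ∂coinMeasure := by
    funext u
    rw [integral_indicator (Ends.measurableSet_prec u)]
    rfl
  rw [heq, continuous_iff_continuousAt]
  intro u
  refine continuousAt_of_dominated (bound := fun _ => (N : ℝ) + |(harmonic n : ℝ)|) ?_ ?_
    (integrable_const _) ?_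
  · exact Eventually.of_forall fun w =>
      (hmeas.indicator (Ends.measurableSet_prec w)).aestronglyMeasurable
  · refine Eventually.of_forall fun w => Eventually.of_forall fun v => ?_
    refine (norm_indicator_le_norm_self _ _).trans ((norm_sub_le _ _).trans ?_)
    rw [Real.norm_eq_abs, Real.norm_eq_abs, Nat.abs_cast]
    gcongr
    exact Nat.sInf_le (hN v)
  · have hne : ∀ᵐ v ∂coinMeasure, v ≠ u := by
      rw [ae_iff]
      simpa using coinMeasure_singleton u
    filter_upwards [hne] with v hv
    have hev : (fun w : Ends => Set.indicator {v : Ends | v.Prec w}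
        (fun v => (x.bdry v : ℝ) - (harmonic n : ℝ)) v) =ᶠ[𝓝 u] fun _ =>
        Set.indicator {v : Ends | v.Prec u} (fun v => (x.bdry v : ℝ) - (harmonic n : ℝ)) v := by
      filter_upwards [Ends.eventually_prec_iff hv] with w hw
      by_cases h : v.Prec u
      · have h' : v.Prec w := hw.2 h
        simp [Set.indicator, h, h']
      · have h' : ¬ v.Prec w := fun hc => h (hw.1 hc)
        simp [Set.indicator, h, h']
    exact (continuousAt_const).congr hev.symm

/-- The smoothed, centred boundary function as an element of the space of continuous functions,
which is a Banach space under the supremum norm. -/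
noncomputable def BinTree.smoothBdry (x : BinTree) (n : ℕ) : C(Ends, ℝ) :=
  ⟨x.smoothBdryFun n, x.continuous_smoothBdryFun n⟩

/-! ### Overlaps of cylinder sets and the potential of a node -/

/-! Two families of martingales carry the proof. The integral of B_{X_n} - H(n) over A_w
(`BinTree.massDefect`) equals ∑_{z ∈ X_n} λ(A_z ∩ A_w) - 2^{-|w|} H(n). The cylinders of the n + 1
external nodes partition the boundary, so a uniformly chosen external node adds 2^{-|w|}/(n + 1) on
average, which is the increment of the centring. The same computation inside the subtree at w, with
the size of that subtree as its clock, makes `BinTree.fringeDefect` a martingale.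

Summed over the external nodes, the squared increments are at most the squares of the overlaps λ(A_z
∩ A_w). These are compensated by the decrease of a potential, so that for |w| = k the second moments
are O(k 4^{-k}) uniformly in time. The maximal inequality, a union bound over the 2^k words of
length k and Borel–Cantelli show that, almost surely, for all large k both martingales stay below
(3/4)^k at all words of length k and all times. Sums of `fringeDefect` over a whole level also tend
to 0, because their increments live on disjoint cylinders and the second moments add.

The set {v ≺ u} is the disjoint union of the cylinders A_{u(k)}, k ∈ K(u), so Y_n(u) is the sum of
the mass defects at these words. Dominated convergence over the levels then gives uniform
convergence to the sum of the limits M(u(k)).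

To identify M, note that for w ∈ X_n the two defects differ by 2^{-|w|} (|w| + H(#X_n(w)) -
H(#X_n)). Hence log(#X_n(w)/#X_n) has a finite limit; this yields X_∞ (by compactness), its
positivity on cylinders, and M(w) = L(w) + 2^{-|w|}(|w| + log X_∞(A_w)) with L the limit of the
fringe defects. Since M is additive over children, L(w) - L(w0) - L(w1) = 2^{-|w|} C(ξ_w).
Telescoping over levels, with the level sums of L tending to 0, gives L = L_∞. -/

namespace Node

/-- The mass `λ(A_z ∩ A_w)`. -/
noncomputable def overlap (z w : Node) : ℝ :=
  if w <+: z then (2 : ℝ)⁻¹ ^ z.length else if z <+: w then (2 : ℝ)⁻¹ ^ w.length else 0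

theorem sq_inv_two_pow (n : ℕ) : ((2 : ℝ)⁻¹ ^ n) ^ 2 = (4 : ℝ)⁻¹ ^ n := by
  rw [← pow_mul, mul_comm, pow_mul]
  norm_num

/-- A function of nodes whose decrease at the replacement of a node by its children is the
square of the overlap with `w`. -/
noncomputable def potential (w z : Node) : ℝ :=
  if w <+: z then 2 * (4 : ℝ)⁻¹ ^ z.length
  else if z <+: w then (2 + w.length - z.length) * (4 : ℝ)⁻¹ ^ w.length else 0

theorem prefix_cases (z w : Node) :
    w <+: z ∨ (∃ b t, w = z ++ b :: t) ∨ (¬ w <+: z ∧ ¬ z <+: w) := by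
  by_cases h : w <+: z
  · exact Or.inl h
  by_cases h' : z <+: w
  · obtain ⟨t, rfl⟩ := h'
    cases t with
    | nil => simp at h
    | cons b t => exact Or.inr (Or.inl ⟨b, t, rfl⟩)
  · exact Or.inr (Or.inr ⟨h, h'⟩)

theorem not_prefix_of_longer {z w : Node} (h : z.length < w.length) : ¬ w <+: z :=
  fun hc => absurd hc.length_le (not_le.2 h)

theorem prefix_child {w z : Node} (h : w <+: z) (b : Bool) : w <+: z ++ [b] :=
  h.trans (List.prefix_append _ _)

theorem not_comparable_child {z w : Node} (h : ¬ w <+: z ∧ ¬ z <+: w) (b : Bool) :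
    ¬ w <+: z ++ [b] ∧ ¬ z ++ [b] <+: w := by
  refine ⟨fun hc => ?_, fun hc => h.2 ((List.prefix_append _ _).trans hc)⟩
  rcases List.prefix_concat_iff.1 hc with rfl | hc
  · exact h.2 (List.prefix_append _ _)
  · exact h.1 hc

theorem child_prefix_append_cons (z t : Node) (b c : Bool) :
    z ++ [c] <+: z ++ b :: t ↔ c = b := by
  rw [List.prefix_append_right_inj]
  simp [List.cons_prefix_cons]

theorem append_cons_prefix_child (z t : Node) (b c : Bool) :
    z ++ b :: t <+: z ++ [c] ↔ b = c ∧ t = [] := by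
  rw [List.prefix_append_right_inj]
  simp [List.cons_prefix_cons]

theorem not_append_cons_prefix (z t : Node) (b : Bool) : ¬ z ++ b :: t <+: z :=
  not_prefix_of_longer (by simp only [List.length_append, List.length_cons]; omega)

theorem overlap_children (z w : Node) :
    overlap (z ++ [false]) w + overlap (z ++ [true]) w = overlap z w := by
  unfold overlap
  rcases prefix_cases z w with h | ⟨b, t, rfl⟩ | h
  · simp only [h, prefix_child h, if_true, List.length_append, List.length_singleton,
      pow_succ]
    ring
  · simp only [child_prefix_append_cons, append_cons_prefix_child, not_append_cons_prefix,
      List.prefix_append]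
    cases b <;> cases t <;> simp
  · simp [h, not_comparable_child h]

theorem overlap_comm (z w : Node) : overlap z w = overlap w z := by
  unfold overlap
  by_cases h : w <+: z <;> by_cases h' : z <+: w <;> simp [h, h']
  rw [h.eq_of_length_le h'.length_le]

theorem overlap_children_right (z w : Node) :
    overlap z (w ++ [false]) + overlap z (w ++ [true]) = overlap z w := by
  rw [overlap_comm z, overlap_comm z, overlap_comm z, overlap_children]

theorem overlap_of_prefix {z w : Node} (h : w <+: z) : overlap z w = (2 : ℝ)⁻¹ ^ z.length :=
  if_pos h

theorem potential_nonneg (w z : Node) : 0 ≤ potential w z := by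
  unfold potential
  split_ifs with h1 h2
  · positivity
  · have : (z.length : ℝ) ≤ w.length := by exact_mod_cast h2.length_le
    have : (0 : ℝ) ≤ 2 + w.length - z.length := by linarith
    positivity
  · exact le_rfl

/-- The potential at z is the sum of `overlap v w ^ 2` over all v ≥ z: below w the levels form a
geometric series with sum 2 · 4^{-|z|}, and each proper prefix of w on the way contributes 4^{-|w|}.
Passing to the children removes the term v = z. -/
theorem potential_children (w z : Node) :
    potential w (z ++ [false]) + potential w (z ++ [true]) = potential w z - overlap z w ^ 2 := by
  have h4 : ∀ n : ℕ, ((2 : ℝ)⁻¹ ^ n) ^ 2 = (4 : ℝ)⁻¹ ^ n := sq_inv_two_pow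
  rcases prefix_cases z w with h | ⟨b, t, rfl⟩ | h
  · simp only [overlap, potential, h, prefix_child h, if_true, List.length_append,
      List.length_singleton, h4]
    rw [pow_succ]
    ring
  · have hov : overlap z (z ++ b :: t) ^ 2 = (4 : ℝ)⁻¹ ^ (z ++ b :: t).length := by
      rw [overlap, if_neg (not_append_cons_prefix _ _ _), if_pos (List.prefix_append _ _), h4]
    rw [hov]
    simp only [potential, child_prefix_append_cons, append_cons_prefix_child,
      not_append_cons_prefix, List.prefix_append]
    cases b <;> cases t <;> simp <;> ring
  · simp [overlap, potential, h, not_comparable_child h]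

theorem potential_le (w z : Node) :
    potential w z ≤ (2 + w.length) * (4 : ℝ)⁻¹ ^ w.length := by
  unfold potential
  have h0 : (0 : ℝ) ≤ (w.length : ℝ) := Nat.cast_nonneg _
  split_ifs with h1 h2
  · gcongr ?_ * ?_
    · linarith
    · exact pow_le_pow_of_le_one (by norm_num) (by norm_num) h1.length_le
  · gcongr
    have : (0 : ℝ) ≤ z.length := Nat.cast_nonneg _
    linarith
  · positivity

end Node

/-! ### Growing a binary tree by an external node -/

namespace BinTree

theorem nil_mem (x : BinTree) : [] ∈ x.nodes := by
  obtain ⟨u, hu⟩ := x.nonempty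
  exact x.prefix_mem u hu [] (List.nil_prefix)

theorem mem_external {x : BinTree} {z : Node} :
    z ∈ x.external ↔ z ∉ x.nodes ∧ ∃ y ∈ x.nodes, ∃ b, z = y ++ [b] := by
  simp only [external, Finset.mem_sdiff, Finset.mem_union, Finset.mem_image]
  constructor
  · rintro ⟨⟨y, hy, rfl⟩ | ⟨y, hy, rfl⟩, h⟩
    · exact ⟨h, y, hy, _, rfl⟩
    · exact ⟨h, y, hy, _, rfl⟩
  · rintro ⟨h, y, hy, b, rfl⟩
    refine ⟨?_, h⟩
    cases b
    · exact Or.inl ⟨y, hy, rfl⟩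
    · exact Or.inr ⟨y, hy, rfl⟩

theorem prefix_external {x : BinTree} {z v : Node} (hz : z ∈ x.external) (hv : v <+: z)
    (hne : v ≠ z) : v ∈ x.nodes := by
  obtain ⟨-, y, hy, b, rfl⟩ := mem_external.1 hz
  rcases List.prefix_concat_iff.1 hv with rfl | h
  · exact absurd rfl hne
  · exact x.prefix_mem y hy v h

open Classical in
/-- The tree obtained from `x` by adding the external node `z`. -/
noncomputable def grow (x : BinTree) (z : Node) : BinTree :=
  if hz : z ∈ x.external then
    { nodes := insert z x.nodes
      nonempty := Finset.insert_nonempty _ _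
      prefix_mem := by
        intro u hu v hv
        rcases Finset.mem_insert.1 hu with rfl | hu
        · by_cases h : v = u
          · exact Finset.mem_insert.2 (Or.inl h)
          · exact Finset.mem_insert_of_mem (prefix_external hz hv h)
        · exact Finset.mem_insert_of_mem (x.prefix_mem u hu v hv) }
  else x

theorem nodes_grow {x : BinTree} {z : Node} (hz : z ∈ x.external) :
    (x.grow z).nodes = insert z x.nodes := by
  rw [grow, dif_pos hz]

theorem sum_nodes_grow {x : BinTree} {z : Node} (hz : z ∈ x.external) (g : Node → ℝ) :
    ∑ v ∈ (x.grow z).nodes, g v = ∑ v ∈ x.nodes, g v + g z := by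
  rw [nodes_grow hz, Finset.sum_insert (mem_external.1 hz).1, add_comm]

theorem card_grow {x : BinTree} {z : Node} (hz : z ∈ x.external) :
    (x.grow z).nodes.card = x.nodes.card + 1 := by
  rw [nodes_grow hz, Finset.card_insert_of_notMem (mem_external.1 hz).1]

theorem grow_injOn (x : BinTree) : Set.InjOn x.grow x.external := by
  intro z hz z' hz' h
  have h1 : z ∈ (x.grow z').nodes := by
    rw [← h, nodes_grow hz]
    exact Finset.mem_insert_self _ _
  rw [nodes_grow hz'] at h1
  rcases Finset.mem_insert.1 h1 with h1 | h1
  · exact h1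
  · exact absurd h1 (mem_external.1 hz).1

theorem child_notMem {x : BinTree} {z : Node} (hz : z ∉ x.nodes) (b : Bool) :
    z ++ [b] ∉ x.nodes :=
  fun h => hz (x.prefix_mem _ h z (List.prefix_append _ _))

theorem external_grow {x : BinTree} {z : Node} (hz : z ∈ x.external) :
    (x.grow z).external = insert (z ++ [false]) (insert (z ++ [true]) (x.external.erase z)) := by
  have hzx := (mem_external.1 hz).1
  ext v
  simp only [Finset.mem_insert, Finset.mem_erase, mem_external, nodes_grow hz]
  constructor
  · rintro ⟨hv, y, rfl | hy, b, rfl⟩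
    · cases b <;> simp
    · refine Or.inr (Or.inr ⟨fun h => hv (Or.inl h), fun h => hv (Or.inr h), y, hy, b, rfl⟩)
  · rintro (rfl | rfl | ⟨h1, h2, y, hy, b, rfl⟩)
    · exact ⟨by simp [child_notMem hzx], z, Or.inl rfl, _, rfl⟩
    · exact ⟨by simp [child_notMem hzx], z, Or.inl rfl, _, rfl⟩
    · exact ⟨by simp [h1, h2], y, Or.inr hy, b, rfl⟩

theorem sum_external_grow {x : BinTree} {z : Node} (hz : z ∈ x.external) (g : Node → ℝ) :
    ∑ v ∈ (x.grow z).external, g v =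
      ∑ v ∈ x.external, g v - g z + (g (z ++ [false]) + g (z ++ [true])) := by
  have h : ∀ b, z ++ [b] ∉ x.external.erase z := by
    intro b hb
    have hb' := prefix_external (Finset.mem_of_mem_erase hb) (List.prefix_append z [b]) (by simp)
    exact (mem_external.1 hz).1 hb'
  rw [external_grow hz, Finset.sum_insert (by simp [-Finset.mem_erase, h]),
    Finset.sum_insert (h _), Finset.sum_erase_eq_sub hz]
  ring

theorem external_root : root.external = {[false], [true]} := by
  rfl

theorem sum_external_root (g : Node → ℝ) :
    ∑ v ∈ root.external, g v = g [false] + g [true] := by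
  rw [external_root, Finset.sum_pair (by simp)]

/-- Every binary tree can be grown from the root. -/
theorem grow_induction {p : BinTree → Prop} (hroot : p root)
    (hgrow : ∀ x, ∀ z ∈ x.external, p x → p (x.grow z)) (x : BinTree) : p x := by
  induction h : x.nodes.card generalizing x with
  | zero => exact absurd (Finset.card_eq_zero.1 h) x.nonempty.ne_empty
  | succ n ih =>
    -- A node of maximal length has no descendants in the tree, so deleting it keeps prefix
    -- stability.
    obtain ⟨z, hz, hmax⟩ := x.nodes.exists_max_image List.length x.nonempty
    rcases List.eq_nil_or_concat' z with rfl | ⟨y, b, hyb⟩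
    · convert hroot
      ext v
      have : v ∈ root.nodes ↔ v = [] := by simp [root]
      rw [this]
      constructor
      · intro hv
        exact List.eq_nil_of_length_eq_zero (Nat.le_zero.1 (hmax v hv))
      · rintro rfl
        exact hz
    · have hzy : y ++ [b] ∈ x.nodes := hyb ▸ hz
      let x' : BinTree :=
        { nodes := x.nodes.erase z
          nonempty := ⟨[], Finset.mem_erase.2 ⟨by simp [hyb], x.nil_mem⟩⟩
          prefix_mem := by
            intro u hu v hv
            obtain ⟨hu1, hu2⟩ := Finset.mem_erase.1 hu
            refine Finset.mem_erase.2 ⟨?_, x.prefix_mem u hu2 v hv⟩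
            rintro rfl
            exact hu1 (hv.eq_of_length_le (hmax u hu2)).symm }
      have hzx' : z ∈ x'.external := by
        refine mem_external.2 ⟨Finset.notMem_erase _ _, y, ?_, b, hyb⟩
        refine Finset.mem_erase.2 ⟨?_, x.prefix_mem _ hzy _ (List.prefix_append _ _)⟩
        rw [hyb]
        simp
      have hx : x'.grow z = x := by
        ext1
        rw [nodes_grow hzx']
        exact Finset.insert_erase hz
      rw [← hx]
      refine hgrow x' z hzx' (ih x' ?_)
      change (x.nodes.erase z).card = n
      rw [Finset.card_erase_of_mem hz, h]
      rfl

theorem card_external (x : BinTree) : (x.external.card : ℝ) = x.nodes.card + 1 := by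
  induction x using grow_induction with
  | hroot => rw [external_root]; simp [root]; norm_num
  | hgrow x z hz ih =>
    have h := sum_external_grow hz (fun _ => 1)
    simp only [Finset.sum_const, nsmul_eq_mul, mul_one] at h
    rw [h, ih, card_grow hz]
    push_cast
    ring

/-- The cylinders of the external nodes partition the boundary, and growing the tree splits one of
them into two. -/
theorem sum_overlap_external (x : BinTree) (w : Node) :
    ∑ z ∈ x.external, z.overlap w = (2 : ℝ)⁻¹ ^ w.length := by
  induction x using grow_induction with
  | hroot =>
    have h := Node.overlap_children [] w
    rw [sum_external_root]
    simp only [List.nil_append] at h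
    rw [h, Node.overlap_comm, Node.overlap_of_prefix List.nil_prefix]
  | hgrow x z hz ih =>
    rw [sum_external_grow hz, Node.overlap_children, ih]
    ring

/-- The nodes of `x` below `w` (including `w`). -/
def below (x : BinTree) (w : Node) : Finset Node := x.nodes.filter (w <+: ·)

theorem card_fringe (x : BinTree) (w : Node) : (x.fringe w).card = (x.below w).card := by
  rw [← Finset.card_image_of_injective (x.fringe w) (List.append_right_injective w)]
  congr 1
  ext v
  simp only [fringe, below, Finset.mem_image, Finset.mem_preimage, Finset.mem_filter]
  constructor
  · rintro ⟨u, hu, rfl⟩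
    exact ⟨hu, List.prefix_append _ _⟩
  · rintro ⟨hv, u, rfl⟩
    exact ⟨u, hv, rfl⟩

theorem below_grow_of_prefix {x : BinTree} {z w : Node} (hz : z ∈ x.external) (h : w <+: z) :
    ((x.grow z).below w).card = (x.below w).card + 1 := by
  rw [below, nodes_grow hz, Finset.filter_insert, if_pos h, Finset.card_insert_of_notMem]
  · rfl
  · simp [(mem_external.1 hz).1]

theorem below_grow_of_not_prefix {x : BinTree} {z w : Node} (hz : z ∈ x.external)
    (h : ¬ w <+: z) : (x.grow z).below w = x.below w := by
  rw [below, nodes_grow hz, Finset.filter_insert, if_neg h]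
  rfl

/-- Either w lies strictly below an external node, or w is a node or an external node. In the second
case the external nodes below w are those of the subtree at w: one more than its nodes, with
cylinders that partition A_w. -/
theorem external_below_cases (x : BinTree) (w : Node) :
    ((∀ z ∈ x.external, ¬ w <+: z) ∧ (x.below w).card = 0) ∨
      (∑ z ∈ x.external, (if w <+: z then (1 : ℝ) else 0) = (x.below w).card + 1 ∧
        ∑ z ∈ x.external, (if w <+: z then (2 : ℝ)⁻¹ ^ z.length else 0) =
          (2 : ℝ)⁻¹ ^ w.length) := by
  induction x using grow_induction with
  | hroot =>
    rw [sum_external_root, sum_external_root, external_root]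
    have hb : root.below w = if w = [] then {[]} else ∅ := by
      simp [below, root, Finset.filter_singleton]
    rw [hb]
    rcases w with _ | ⟨b, _ | ⟨c, t⟩⟩
    · right; norm_num
    · right; cases b <;> simp [List.cons_prefix_cons]
    · left; simp [List.cons_prefix_cons]
  | hgrow x z hz ih =>
    by_cases h : w <+: z
    · right
      rcases ih with ih | ⟨ih1, ih2⟩
      · exact absurd h (ih.1 z hz)
      · rw [sum_external_grow hz, sum_external_grow hz, ih1, ih2, below_grow_of_prefix hz h]
        simp only [h, Node.prefix_child h, if_true, List.length_append,
          List.length_singleton, pow_succ]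
        push_cast
        constructor <;> ring
    · rw [sum_external_grow hz, sum_external_grow hz, below_grow_of_not_prefix hz h,
        external_grow hz]
      simp only [Finset.forall_mem_insert, h, if_false]
      rcases Node.prefix_cases z w with h' | ⟨b, t, rfl⟩ | h'
      · exact absurd h' h
      -- Here w lies strictly below the external node z; an external node below w would turn z into
      -- a node of the tree.
      · have hno : ∀ v ∈ x.external, ¬ z ++ b :: t <+: v := by
          intro v hv hp
          have hzv : z <+: v := (List.prefix_append _ _).trans hp
          refine (mem_external.1 hz).1 (prefix_external hv hzv ?_)
          rintro rfl
          exact h hp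
        have hm : (x.below (z ++ b :: t)).card = 0 := by
          rcases ih with ih | ⟨ih, -⟩
          · exact ih.2
          · rw [Finset.sum_eq_zero fun v hv => if_neg (hno v hv)] at ih
            have : (0 : ℝ) ≤ (x.below (z ++ b :: t)).card := Nat.cast_nonneg _
            linarith
        rw [hm, Finset.sum_eq_zero fun v hv => if_neg (hno v hv),
          Finset.sum_eq_zero fun v hv => if_neg (hno v hv)]
        simp only [Node.append_cons_prefix_child]
        -- If w is a child of z it becomes external itself, which is the second alternative with an
        -- empty subtree; otherwise it stays strictly below an external node.
        rcases t with _ | ⟨c, t⟩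
        · right
          cases b <;> simp
        · left
          simp only [reduceCtorEq, and_false, not_false_eq_true, true_and, and_true]
          exact fun v hv => hno v (Finset.mem_of_mem_erase hv)
      · have h0 := (Node.not_comparable_child h' false).1
        have h1 := (Node.not_comparable_child h' true).1
        simp only [h0, h1, if_false, not_false_eq_true, true_and, sub_zero, add_zero]
        rcases ih with ih | ih
        · exact Or.inl ⟨fun v hv => ih.1 v (Finset.mem_of_mem_erase hv), ih.2⟩
        · exact Or.inr ih

end BinTree

/-! ### Harmonic functions of binary trees -/

namespace BinTree

/-- The mean of `F` after one step of the chain, started at `x`. -/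
noncomputable def stepMean (F : BinTree → ℝ) (x : BinTree) : ℝ :=
  (∑ z ∈ x.external, F (x.grow z)) / x.external.card

/-- `F` is harmonic for the binary search tree chain. -/
def Harmonic (F : BinTree → ℝ) : Prop :=
  ∀ x : BinTree, ∑ z ∈ x.external, (F (x.grow z) - F x) = 0

theorem card_external_pos (x : BinTree) : (0 : ℝ) < x.external.card := by
  rw [card_external]
  positivity

theorem stepMean_eq (F : BinTree → ℝ) (x : BinTree) :
    stepMean F x = F x + (∑ z ∈ x.external, (F (x.grow z) - F x)) / x.external.card := by
  rw [stepMean, Finset.sum_sub_distrib, Finset.sum_const, nsmul_eq_mul]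
  field_simp [x.card_external_pos.ne']
  ring

theorem Harmonic.stepMean_eq {F : BinTree → ℝ} (hF : Harmonic F) (x : BinTree) :
    stepMean F x = F x := by
  rw [BinTree.stepMean_eq, hF x, zero_div, add_zero]

/-- The cross term vanishes by harmonicity: increments of a martingale are orthogonal to its past.
-/
theorem Harmonic.sum_sq {F : BinTree → ℝ} (hF : Harmonic F) (x : BinTree) :
    ∑ z ∈ x.external, (F (x.grow z) ^ 2 - F x ^ 2) =
      ∑ z ∈ x.external, (F (x.grow z) - F x) ^ 2 := by
  have h : ∀ z ∈ x.external, F (x.grow z) ^ 2 - F x ^ 2 =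
      (F (x.grow z) - F x) ^ 2 + 2 * F x * (F (x.grow z) - F x) := fun z _ => by ring
  rw [Finset.sum_congr rfl h, Finset.sum_add_distrib, ← Finset.mul_sum, hF x]
  ring

theorem Harmonic.sq_le_stepMean {F : BinTree → ℝ} (hF : Harmonic F) (x : BinTree) :
    F x ^ 2 ≤ stepMean (fun y => F y ^ 2) x := by
  rw [BinTree.stepMean_eq, hF.sum_sq]
  have : 0 ≤ (∑ z ∈ x.external, (F (x.grow z) - F x) ^ 2) / x.external.card := by positivity
  linarith

theorem Harmonic.sum {ι : Type*} (s : Finset ι) {F : ι → BinTree → ℝ}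
    (hF : ∀ i ∈ s, Harmonic (F i)) : Harmonic (fun x => ∑ i ∈ s, F i x) := by
  intro x
  simp only [← Finset.sum_sub_distrib]
  rw [Finset.sum_comm]
  exact Finset.sum_eq_zero fun i hi => hF i hi x

/-! ### Compensation of squared increments by an energy -/

/-- The total potential of the external nodes. -/
noncomputable def energy {ι : Type*} (s : Finset ι) (w : ι → Node) (x : BinTree) : ℝ :=
  ∑ i ∈ s, ∑ z ∈ x.external, Node.potential (w i) z

theorem energy_nonneg {ι : Type*} (s : Finset ι) (w : ι → Node) (x : BinTree) :
    0 ≤ energy s w x :=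
  Finset.sum_nonneg fun _ _ => Finset.sum_nonneg fun _ _ => Node.potential_nonneg _ _

theorem energy_root_le {ι : Type*} (s : Finset ι) (w : ι → Node) :
    energy s w root ≤ ∑ i ∈ s, 2 * ((2 + (w i).length) * (4 : ℝ)⁻¹ ^ (w i).length) := by
  refine Finset.sum_le_sum fun i _ => ?_
  rw [sum_external_root]
  linarith [Node.potential_le (w i) [false], Node.potential_le (w i) [true]]

theorem energy_grow {ι : Type*} (s : Finset ι) (w : ι → Node) {x : BinTree} {z : Node}
    (hz : z ∈ x.external) :
    energy s w (x.grow z) - energy s w x = -∑ i ∈ s, z.overlap (w i) ^ 2 := by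
  rw [energy, energy, ← Finset.sum_sub_distrib, ← Finset.sum_neg_distrib]
  refine Finset.sum_congr rfl fun i _ => ?_
  rw [sum_external_grow hz, Node.potential_children]
  ring

/-- `F` is harmonic, and its squared increments are compensated by the energy. -/
structure Compensated {ι : Type*} (F : BinTree → ℝ) (s : Finset ι) (w : ι → Node) : Prop where
  harmonic : Harmonic F
  sq_le : ∀ x : BinTree, ∑ z ∈ x.external, (F (x.grow z) - F x) ^ 2 ≤
    ∑ z ∈ x.external, ∑ i ∈ s, z.overlap (w i) ^ 2

/-- The mean gain of F² in one step is the mean squared increment, and the energy loses at least as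
much. So F² plus energy is a supermartingale, and its initial value bounds all second moments. -/
theorem Compensated.stepMean_le {ι : Type*} {F : BinTree → ℝ} {s : Finset ι} {w : ι → Node}
    (h : Compensated F s w) (x : BinTree) :
    stepMean (fun y => F y ^ 2 + energy s w y) x ≤ F x ^ 2 + energy s w x := by
  rw [BinTree.stepMean_eq]
  have h1 : ∑ z ∈ x.external, (F (x.grow z) ^ 2 + energy s w (x.grow z) -
      (F x ^ 2 + energy s w x)) = ∑ z ∈ x.external, (F (x.grow z) - F x) ^ 2 -
        ∑ z ∈ x.external, ∑ i ∈ s, z.overlap (w i) ^ 2 := by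
    rw [← h.harmonic.sum_sq, ← Finset.sum_sub_distrib]
    refine Finset.sum_congr rfl fun z hz => ?_
    linarith [energy_grow s w hz]
  have h2 := h.sq_le x
  rw [h1]
  have : (∑ z ∈ x.external, (F (x.grow z) - F x) ^ 2 -
    ∑ z ∈ x.external, ∑ i ∈ s, z.overlap (w i) ^ 2) / x.external.card ≤ 0 :=
    div_nonpos_of_nonpos_of_nonneg (by linarith) x.card_external_pos.le
  linarith

/-! ### The defects of a node as compensated harmonic functions -/

theorem harmonic_succ_cast (n : ℕ) :
    ((_root_.harmonic (n + 1) : ℚ) : ℝ) = (_root_.harmonic n : ℝ) + ((n : ℝ) + 1)⁻¹ := by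
  rw [harmonic_succ]
  push_cast
  ring

/-- The integral of the centred boundary function over the cylinder set `A_w`. -/
noncomputable def massDefect (w : Node) (x : BinTree) : ℝ :=
  ∑ z ∈ x.nodes, z.overlap w - (2 : ℝ)⁻¹ ^ w.length * (harmonic x.nodes.card : ℝ)

/-- The integral of the centred boundary function of the subtree rooted at `w`, in the scale of
the cylinder set `A_w`. -/
noncomputable def fringeDefect (w : Node) (x : BinTree) : ℝ :=
  ∑ z ∈ x.below w, (2 : ℝ)⁻¹ ^ z.length - (2 : ℝ)⁻¹ ^ w.length * (harmonic (x.below w).card : ℝ)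

theorem massDefect_root (w : Node) : massDefect w root = 0 := by
  simp [massDefect, root, Node.overlap_comm [] w, Node.overlap_of_prefix List.nil_prefix]

theorem fringeDefect_root (w : Node) : fringeDefect w root = 0 := by
  by_cases h : w = []
  · subst h
    simp [fringeDefect, below, root]
  · simp [fringeDefect, below, root, Finset.filter_singleton, h]

theorem massDefect_grow (w : Node) {x : BinTree} {z : Node} (hz : z ∈ x.external) :
    massDefect w (x.grow z) - massDefect w x =
      z.overlap w - (2 : ℝ)⁻¹ ^ w.length * (x.external.card : ℝ)⁻¹ := by
  rw [massDefect, massDefect, sum_nodes_grow hz, card_grow hz, harmonic_succ_cast, card_external]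
  ring

/-- The subtracted constant is the mean of `z.overlap w` over the external nodes z. Hence the
increments have mean zero, and centring can only lower the sum of squares. -/
theorem compensated_massDefect (w : Node) :
    Compensated (massDefect w) (Finset.univ : Finset Unit) (fun _ => w) := by
  have hc : ∀ x : BinTree, (x.external.card : ℝ) * (x.external.card : ℝ)⁻¹ = 1 := fun x =>
    mul_inv_cancel₀ x.card_external_pos.ne'
  constructor
  · intro x
    rw [Finset.sum_congr rfl fun z hz => massDefect_grow w hz, Finset.sum_sub_distrib,
      sum_overlap_external, Finset.sum_const, nsmul_eq_mul]
    linear_combination (-(2 : ℝ)⁻¹ ^ w.length) * hc x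
  · intro x
    simp only [Finset.univ_unique, Finset.sum_singleton]
    have h1 : ∀ z ∈ x.external, (massDefect w (x.grow z) - massDefect w x) ^ 2 =
        z.overlap w ^ 2 - (2 * (2 : ℝ)⁻¹ ^ w.length * (x.external.card : ℝ)⁻¹) * z.overlap w +
          ((2 : ℝ)⁻¹ ^ w.length) ^ 2 * (x.external.card : ℝ)⁻¹ ^ 2 := fun z hz => by
      rw [massDefect_grow w hz]
      ring
    rw [Finset.sum_congr rfl h1, Finset.sum_add_distrib, Finset.sum_sub_distrib, Finset.sum_const,
      ← Finset.mul_sum, sum_overlap_external, nsmul_eq_mul]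
    have h2 : 0 ≤ ((2 : ℝ)⁻¹ ^ w.length) ^ 2 * (x.external.card : ℝ)⁻¹ := by positivity
    linear_combination h2 + ((2 : ℝ)⁻¹ ^ w.length) ^ 2 * (x.external.card : ℝ)⁻¹ * hc x

theorem fringeDefect_grow (w : Node) {x : BinTree} {z : Node} (hz : z ∈ x.external) :
    fringeDefect w (x.grow z) - fringeDefect w x =
      if w <+: z then (2 : ℝ)⁻¹ ^ z.length -
        (2 : ℝ)⁻¹ ^ w.length * (((x.below w).card : ℝ) + 1)⁻¹ else 0 := by
  split_ifs with h
  · have h1 : ∑ v ∈ (x.grow z).below w, (2 : ℝ)⁻¹ ^ v.length =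
        ∑ v ∈ x.below w, (2 : ℝ)⁻¹ ^ v.length + (2 : ℝ)⁻¹ ^ z.length := by
      rw [below, below, Finset.sum_filter, sum_nodes_grow hz, if_pos h, Finset.sum_filter]
    rw [fringeDefect, fringeDefect, below_grow_of_prefix hz h, h1, harmonic_succ_cast]
    ring
  · rw [fringeDefect, fringeDefect, below_grow_of_not_prefix hz h, sub_self]

/-- Only external nodes below w matter. If there are any, they are those of the subtree at w and the
argument for the whole tree applies to them; if there are none, nothing changes. -/
theorem sum_fringeDefect_grow (w : Node) (x : BinTree) :
    ∑ z ∈ x.external, (fringeDefect w (x.grow z) - fringeDefect w x) = 0 ∧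
      ∑ z ∈ x.external, (fringeDefect w (x.grow z) - fringeDefect w x) ^ 2 ≤
        ∑ z ∈ x.external, z.overlap w ^ 2 := by
  rw [Finset.sum_congr rfl fun z hz => fringeDefect_grow w hz,
    Finset.sum_congr rfl fun z hz => congrArg (· ^ 2) (fringeDefect_grow w hz)]
  rcases x.external_below_cases w with ⟨h, -⟩ | ⟨h1, h2⟩
  · rw [Finset.sum_eq_zero fun z hz => if_neg (h z hz),
      Finset.sum_eq_zero fun z hz => by simp [h z hz]]
    exact ⟨rfl, Finset.sum_nonneg fun _ _ => sq_nonneg _⟩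
  · set m : ℝ := ((x.below w).card : ℝ) + 1 with hm
    have hm0 : 0 < m := by positivity
    have hc : m * m⁻¹ = 1 := mul_inv_cancel₀ hm0.ne'
    set a : ℝ := (2 : ℝ)⁻¹ ^ w.length
    constructor
    · have h3 : ∀ z ∈ x.external,
          (if w <+: z then (2 : ℝ)⁻¹ ^ z.length - a * m⁻¹ else 0) =
            (if w <+: z then (2 : ℝ)⁻¹ ^ z.length else 0) -
              a * m⁻¹ * (if w <+: z then (1 : ℝ) else 0) := fun z _ => by split_ifs <;> ring
      rw [Finset.sum_congr rfl h3, Finset.sum_sub_distrib, ← Finset.mul_sum, h1, h2]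
      linear_combination (-a) * hc
    · have h3 : ∀ z ∈ x.external,
          (if w <+: z then (2 : ℝ)⁻¹ ^ z.length - a * m⁻¹ else 0) ^ 2 ≤
            z.overlap w ^ 2 - 2 * a * m⁻¹ * (if w <+: z then (2 : ℝ)⁻¹ ^ z.length else 0) +
              (a * m⁻¹) ^ 2 * (if w <+: z then (1 : ℝ) else 0) := fun z _ => by
        split_ifs with h
        · rw [Node.overlap_of_prefix h]
          apply le_of_eq
          ring
        · have := sq_nonneg (z.overlap w)
          linarith
      refine (Finset.sum_le_sum h3).trans ?_
      rw [Finset.sum_add_distrib, Finset.sum_sub_distrib, ← Finset.mul_sum, ← Finset.mul_sum,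
        h1, h2]
      have h4 : 0 ≤ a ^ 2 * m⁻¹ := by positivity
      linear_combination h4 + a ^ 2 * m⁻¹ * hc

theorem sq_sum_of_mul_eq_zero {ι : Type*} (s : Finset ι) (a : ι → ℝ)
    (h : ∀ i ∈ s, ∀ j ∈ s, i ≠ j → a i * a j = 0) : (∑ i ∈ s, a i) ^ 2 = ∑ i ∈ s, a i ^ 2 := by
  rw [sq, Finset.sum_mul_sum]
  refine Finset.sum_congr rfl fun i hi => ?_
  rw [Finset.sum_eq_single i (fun j hj hji => h i hi j hj hji.symm) (fun hc => absurd hi hc), sq]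

/-- An external node lies below at most one word of a given length, so at most one summand changes
in a step and the squares add without cross terms. The energy of a level thus grows only linearly in
the number of words. -/
theorem compensated_sum_fringeDefect {ι : Type*} (s : Finset ι) (w : ι → Node) (k : ℕ)
    (hw : Function.Injective w) (hk : ∀ i, (w i).length = k) :
    Compensated (fun x => ∑ i ∈ s, fringeDefect (w i) x) s w := by
  constructor
  · exact Harmonic.sum s fun i _ x => (sum_fringeDefect_grow (w i) x).1
  · intro x
    simp only [← Finset.sum_sub_distrib]
    have h : ∀ z ∈ x.external,
        (∑ i ∈ s, (fringeDefect (w i) (x.grow z) - fringeDefect (w i) x)) ^ 2 =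
          ∑ i ∈ s, (fringeDefect (w i) (x.grow z) - fringeDefect (w i) x) ^ 2 := by
      intro z hz
      refine sq_sum_of_mul_eq_zero _ _ fun i _ j _ hij => ?_
      rw [fringeDefect_grow _ hz, fringeDefect_grow _ hz]
      by_cases h1 : w i <+: z
      · by_cases h2 : w j <+: z
        · refine absurd (hw ?_) hij
          exact (List.prefix_of_prefix_length_le h1 h2 (by rw [hk, hk])).eq_of_length
            (by rw [hk, hk])
        · rw [if_neg h2, mul_zero]
      · rw [if_neg h1, zero_mul]
    rw [Finset.sum_congr rfl h, Finset.sum_comm, Finset.sum_comm (s := x.external)]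
    exact Finset.sum_le_sum fun i _ => (sum_fringeDefect_grow (w i) x).2

theorem massDefect_children (w : Node) (x : BinTree) :
    massDefect (w ++ [false]) x + massDefect (w ++ [true]) x = massDefect w x := by
  have h : ∑ z ∈ x.nodes, z.overlap w = ∑ z ∈ x.nodes, z.overlap (w ++ [false]) +
      ∑ z ∈ x.nodes, z.overlap (w ++ [true]) := by
    rw [← Finset.sum_add_distrib]
    exact Finset.sum_congr rfl fun z _ => (Node.overlap_children_right z w).symm
  rw [massDefect, massDefect, massDefect, h]
  simp only [List.length_append, List.length_singleton, pow_succ]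
  ring

end BinTree

/-! ### Martingales built on the binary search tree chain -/

namespace BinTree

instance : Countable BinTree :=
  Function.Injective.countable (f := BinTree.nodes) fun _ _ h => BinTree.ext h

theorem trans_grow {x : BinTree} {z : Node} (hz : z ∈ x.external) :
    trans x (x.grow z) = (x.external.card : ENNReal)⁻¹ := by
  classical
  rw [trans, if_pos]
  refine ⟨z, hz, ?_⟩
  rw [nodes_grow hz]

theorem exists_grow_of_trans_ne_zero {x y : BinTree} (h : trans x y ≠ 0) :
    ∃ z ∈ x.external, y = x.grow z := by
  classical
  rw [trans] at h
  obtain ⟨z, hz, hy⟩ := (ite_ne_right_iff.1 h).1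
  refine ⟨z, hz, BinTree.ext ?_⟩
  rw [hy, nodes_grow hz]

end BinTree

/-- The initial segment `(X₁, …, X_{n + 1})` of a sequence of trees. -/
def chainPath {Ω : Type*} (X : ℕ → Ω → BinTree) (n : ℕ) (ω : Ω) : Fin (n + 1) → BinTree :=
  fun i => X (i + 1) ω

namespace IsBSTChain

variable {Ω : Type*} [MeasurableSpace Ω] {P : Measure Ω} {X : ℕ → Ω → BinTree}

theorem measurable_chainPath (hX : IsBSTChain P X) (n : ℕ) : Measurable (chainPath X n) :=
  measurable_pi_lambda _ fun i => hX.measurable (i + 1) (by omega)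

theorem measurable_comp (hX : IsBSTChain P X) {β : Type*} [MeasurableSpace β] (F : BinTree → β)
    (n : ℕ) : Measurable (fun ω => F (X (n + 1) ω)) :=
  (measurable_from_top (f := F)).comp (hX.measurable (n + 1) (by omega))

theorem measure_chainPath_step (hX : IsBSTChain P X) (n : ℕ) (p : Fin (n + 1) → BinTree)
    (y : BinTree) :
    P ({ω | chainPath X n ω = p} ∩ {ω | X (n + 2) ω = y}) =
      P {ω | chainPath X n ω = p} * BinTree.trans (p (Fin.last n)) y := by
  -- The path `p` lists X₁, …, X_{n+1} from index 0; `x` shifts it to start at 1 and continues it by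
  -- `y`.
  let x : ℕ → BinTree := fun i => if h : i - 1 < n + 1 then p ⟨i - 1, h⟩ else y
  have hx1 : ∀ i : Fin (n + 1), x (i + 1) = p i := fun i => by
    have := i.2
    simp only [x, Nat.add_sub_cancel, this, dif_pos]
  have hx2 : x (n + 2) = y := by simp [x]
  have h1 : {ω | ∀ i ∈ Finset.Icc 1 (n + 1), X i ω = x i} = {ω | chainPath X n ω = p} := by
    ext ω
    simp only [Set.mem_ofPred_eq, Finset.mem_Icc]
    constructor
    · intro h
      funext i
      rw [← hx1]
      exact h (i + 1) (by omega)
    · rintro rfl i ⟨hi1, hi2⟩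
      obtain ⟨j, rfl⟩ : ∃ j, i = j + 1 := ⟨i - 1, by omega⟩
      exact (hx1 ⟨j, by omega⟩).symm
  have h2 : {ω | ∀ i ∈ Finset.Icc 1 (n + 1 + 1), X i ω = x i} =
      {ω | chainPath X n ω = p} ∩ {ω | X (n + 2) ω = y} := by
    rw [← h1]
    ext ω
    simp only [Set.mem_ofPred_eq, Finset.mem_Icc, Set.mem_inter_iff]
    constructor
    · intro h
      exact ⟨fun i hi => h i (by omega), hx2 ▸ h (n + 2) (by omega)⟩
    · rintro ⟨h, h'⟩ i ⟨hi1, hi2⟩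
      rcases Nat.lt_or_ge i (n + 2) with hi | hi
      · exact h i (by omega)
      · obtain rfl : i = n + 2 := by omega
        rw [hx2, h']
  have hm := hX.markov (n + 1) (by omega) x
  rw [h1, h2, hx2] at hm
  rw [hm]
  congr 2
  exact hx1 (Fin.last n)

theorem ae_grow (hX : IsBSTChain P X) :
    ∀ᵐ ω ∂P, ∀ n, ∃ z ∈ (X (n + 1) ω).external, X (n + 2) ω = (X (n + 1) ω).grow z := by
  rw [ae_all_iff]
  intro n
  have h : ∀ᵐ ω ∂P, ∀ (p : Fin (n + 1) → BinTree) (y : BinTree),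
      BinTree.trans (p (Fin.last n)) y = 0 → ¬ (chainPath X n ω = p ∧ X (n + 2) ω = y) := by
    rw [ae_all_iff]
    intro p
    rw [ae_all_iff]
    intro y
    by_cases hy : BinTree.trans (p (Fin.last n)) y = 0
    · have := hX.measure_chainPath_step n p y
      rw [hy, mul_zero] at this
      filter_upwards [measure_eq_zero_iff_ae_notMem.1 this] with ω hω _
      exact hω
    · exact Eventually.of_forall fun ω h => absurd h hy
  filter_upwards [h] with ω hω
  refine BinTree.exists_grow_of_trans_ne_zero fun h0 => ?_
  exact hω (chainPath X n ω) (X (n + 2) ω) h0 ⟨rfl, rfl⟩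

theorem ae_card (hX : IsBSTChain P X) : ∀ᵐ ω ∂P, ∀ n, (X (n + 1) ω).nodes.card = n + 1 := by
  filter_upwards [hX.ae_grow, hX.start] with ω h1 h2 n
  induction n with
  | zero => rw [zero_add, h2]; rfl
  | succ n ih =>
    obtain ⟨z, hz, h⟩ := h1 n
    rw [h, BinTree.card_grow hz, ih]

/-- At each time only finitely many trees are reachable, so every functional of the tree is almost
surely bounded, hence integrable. -/
theorem ae_mem_finset (hX : IsBSTChain P X) (n : ℕ) :
    ∃ s : Finset BinTree, ∀ᵐ ω ∂P, X (n + 1) ω ∈ s := by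
  classical
  induction n with
  | zero =>
    refine ⟨{BinTree.root}, ?_⟩
    filter_upwards [hX.start] with ω h
    simpa using h
  | succ n ih =>
    obtain ⟨s, hs⟩ := ih
    refine ⟨s.biUnion fun x => x.external.image x.grow, ?_⟩
    filter_upwards [hs, hX.ae_grow] with ω h1 h2
    obtain ⟨z, hz, h⟩ := h2 n
    exact Finset.mem_biUnion.2 ⟨_, h1, Finset.mem_image.2 ⟨z, hz, h.symm⟩⟩

theorem measurableSet_chainPath (hX : IsBSTChain P X) (n : ℕ) (p : Fin (n + 1) → BinTree) :
    MeasurableSet {ω | chainPath X n ω = p} :=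
  hX.measurable_chainPath n (measurableSet_singleton p)

variable [IsProbabilityMeasure P]

theorem integrable_comp (hX : IsBSTChain P X) (F : BinTree → ℝ) (n : ℕ) :
    Integrable (fun ω => F (X (n + 1) ω)) P := by
  obtain ⟨s, hs⟩ := hX.ae_mem_finset n
  refine Integrable.of_bound (hX.measurable_comp F n).aestronglyMeasurable (∑ x ∈ s, ‖F x‖) ?_
  filter_upwards [hs] with ω h
  exact Finset.single_le_sum (f := fun x => ‖F x‖) (fun _ _ => norm_nonneg _) h

theorem setIntegral_chainPath_step (hX : IsBSTChain P X) (F : BinTree → ℝ) (n : ℕ)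
    (p : Fin (n + 1) → BinTree) :
    ∫ ω in {ω | chainPath X n ω = p}, F (X (n + 2) ω) ∂P =
      P.real {ω | chainPath X n ω = p} * BinTree.stepMean F (p (Fin.last n)) := by
  set x := p (Fin.last n) with hx
  set A := {ω | chainPath X n ω = p} with hA
  have hB : ∀ y, MeasurableSet {ω | X (n + 2) ω = y} := fun y =>
    hX.measurable (n + 2) (by omega) (measurableSet_singleton y)
  -- Given the path, the next tree is `x.grow z` for exactly one external z, since `grow` is
  -- injective there; each value carries the fraction 1/#external of the mass.
  have h1 : ∀ᵐ ω ∂P.restrict A, F (X (n + 2) ω) =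
      ∑ z ∈ x.external, {ω | X (n + 2) ω = x.grow z}.indicator (fun _ => F (x.grow z)) ω := by
    rw [ae_restrict_iff' (hX.measurableSet_chainPath n p)]
    filter_upwards [hX.ae_grow] with ω h hω
    have hxω : X (n + 1) ω = x := by
      rw [hx, ← (show chainPath X n ω = p from hω)]
      rfl
    obtain ⟨z, hz, hzω⟩ := h n
    rw [hxω] at hz hzω
    rw [Finset.sum_eq_single z]
    · rw [Set.indicator_of_mem (by exact hzω), hzω]
    · intro z' hz' hne
      refine Set.indicator_of_notMem (fun hc => hne ?_) _
      exact x.grow_injOn hz' hz (Eq.trans (Eq.symm hc) hzω)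
    · exact fun hc => absurd hz hc
  rw [integral_congr_ae h1, integral_finsetSum _ fun z _ =>
    (integrable_const _).indicator (hB _)]
  have h2 : ∀ z ∈ x.external,
      ∫ ω in A, {ω | X (n + 2) ω = x.grow z}.indicator (fun _ => F (x.grow z)) ω ∂P =
        P.real A * F (x.grow z) / x.external.card := by
    intro z hz
    rw [setIntegral_indicator (hB _), setIntegral_const, measureReal_def,
      hX.measure_chainPath_step n p, BinTree.trans_grow hz, ENNReal.toReal_mul, measureReal_def,
      ENNReal.toReal_inv, ENNReal.toReal_natCast, smul_eq_mul]
    ring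
  rw [Finset.sum_congr rfl h2, BinTree.stepMean, ← Finset.sum_div, ← Finset.mul_sum, mul_div_assoc]

/-- The natural filtration of `X₁, X₂, …`. -/
def filtration (hX : IsBSTChain P X) : Filtration ℕ ‹MeasurableSpace Ω› where
  seq n := MeasurableSpace.comap (chainPath X n) MeasurableSpace.pi
  mono' := by
    intro m n hmn
    rintro _ ⟨T, hT, rfl⟩
    refine ⟨(fun p i => p (Fin.castLE (by omega) i)) ⁻¹' T, ?_, rfl⟩
    exact (Set.to_countable _).measurableSet
  le' n := (hX.measurable_chainPath n).comap_le

/-- An event of the filtration is a countable disjoint union of path atoms, so the one-step formula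
on atoms gives the Markov property in integrated form. -/
theorem setIntegral_step (hX : IsBSTChain P X) (F : BinTree → ℝ) (n : ℕ) {s : Set Ω}
    (hs : MeasurableSet[hX.filtration n] s) :
    ∫ ω in s, F (X (n + 2) ω) ∂P = ∫ ω in s, BinTree.stepMean F (X (n + 1) ω) ∂P := by
  obtain ⟨T, -, rfl⟩ := hs
  have h : chainPath X n ⁻¹' T = ⋃ p : T, {ω | chainPath X n ω = p} := by
    ext ω
    simp
  have hd : Pairwise (Function.onFun Disjoint fun p : T => {ω | chainPath X n ω = p}) := by
    intro p q hpq
    refine Set.disjoint_left.2 fun ω h1 h2 => hpq (Subtype.ext ?_)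
    exact (Eq.symm h1).trans h2
  rw [h, integral_iUnion (fun p : T => hX.measurableSet_chainPath n p) hd
    (hX.integrable_comp F (n + 1)).integrableOn,
    integral_iUnion (fun p : T => hX.measurableSet_chainPath n p) hd
    (hX.integrable_comp _ n).integrableOn]
  refine tsum_congr fun p => ?_
  rw [hX.setIntegral_chainPath_step, setIntegral_congr_fun (g := fun _ =>
    BinTree.stepMean F ((p : Fin (n + 1) → BinTree) (Fin.last n)))
    (hX.measurableSet_chainPath n p), setIntegral_const, smul_eq_mul]
  intro ω hω
  change _ = BinTree.stepMean F (p.1 (Fin.last n))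
  rw [← (show chainPath X n ω = p from hω)]
  rfl

/-! ### Martingale convergence and the maximal inequality -/

theorem submartingale (hX : IsBSTChain P X) {F : BinTree → ℝ}
    (hF : ∀ x, F x ≤ BinTree.stepMean F x) :
    Submartingale (fun n ω => F (X (n + 1) ω)) hX.filtration P := by
  refine submartingale_of_setIntegral_le_succ (fun n => ?_) (hX.integrable_comp F) ?_
  · refine Measurable.stronglyMeasurable ?_
    have h1 : Measurable[hX.filtration n] (chainPath X n) := comap_measurable _
    have h2 : Measurable fun p : Fin (n + 1) → BinTree => F (p (Fin.last n)) :=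
      measurable_from_top.comp (measurable_pi_apply _)
    exact h2.comp h1
  · intro n s hs
    rw [hX.setIntegral_step F n hs]
    exact setIntegral_mono (hX.integrable_comp F n).integrableOn
      (hX.integrable_comp _ n).integrableOn fun ω => hF _

theorem integral_le_root (hX : IsBSTChain P X) {G : BinTree → ℝ}
    (hG : ∀ x, BinTree.stepMean G x ≤ G x) (n : ℕ) :
    ∫ ω, G (X (n + 1) ω) ∂P ≤ G BinTree.root := by
  induction n with
  | zero =>
    apply le_of_eq
    rw [integral_congr_ae (g := fun _ => G BinTree.root)]
    · simp
    · filter_upwards [hX.start] with ω h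
      rw [zero_add, h]
  | succ n ih =>
    refine le_trans ?_ ih
    have h := hX.setIntegral_step G n MeasurableSet.univ
    rw [setIntegral_univ, setIntegral_univ] at h
    rw [h]
    exact integral_mono (hX.integrable_comp _ n) (hX.integrable_comp G n) fun ω => hG _

theorem integral_sq_le (hX : IsBSTChain P X) {ι : Type*} {F : BinTree → ℝ} {s : Finset ι}
    {w : ι → Node} (hF : BinTree.Compensated F s w) (h0 : F BinTree.root = 0) (n : ℕ) :
    ∫ ω, F (X (n + 1) ω) ^ 2 ∂P ≤ BinTree.energy s w BinTree.root := by
  have h := hX.integral_le_root hF.stepMean_le n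
  rw [h0, zero_pow two_ne_zero, zero_add] at h
  refine le_trans (integral_mono (hX.integrable_comp (fun x => F x ^ 2) n)
    (hX.integrable_comp (fun x => F x ^ 2 + BinTree.energy s w x) n) fun ω => ?_) h
  exact le_add_of_nonneg_right (BinTree.energy_nonneg _ _ _)

theorem ae_tendsto (hX : IsBSTChain P X) {ι : Type*} {F : BinTree → ℝ} {s : Finset ι}
    {w : ι → Node} (hF : BinTree.Compensated F s w) (h0 : F BinTree.root = 0) :
    ∀ᵐ ω ∂P, ∃ c, Tendsto (fun n => F (X (n + 1) ω)) atTop (𝓝 c) := by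
  refine (hX.submartingale fun x => (hF.harmonic.stepMean_eq x).ge).exists_ae_tendsto_of_bdd
    (R := (1 + BinTree.energy s w BinTree.root).toNNReal) fun n => ?_
  rw [eLpNorm_one_eq_lintegral_enorm, ← ofReal_integral_norm_eq_lintegral_enorm
    (hX.integrable_comp F n)]
  refine ENNReal.ofReal_le_ofReal ?_
  have h1 : ∫ ω, ‖F (X (n + 1) ω)‖ ∂P ≤ ∫ ω, (1 + F (X (n + 1) ω) ^ 2) ∂P := by
    refine integral_mono (hX.integrable_comp F n).norm
      (hX.integrable_comp (fun x => 1 + F x ^ 2) n) fun ω => ?_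
    change |_| ≤ _
    -- The bound |a| ≤ 1 + a² turns the uniform second moment bound into the L¹ bound needed for
    -- martingale convergence.
    nlinarith [sq_abs (F (X (n + 1) ω)), sq_nonneg (|F (X (n + 1) ω)| - 1)]
  rw [integral_add (integrable_const _) (hX.integrable_comp (fun x => F x ^ 2) n)] at h1
  have h2 := hX.integral_sq_le hF h0 n
  simp only [integral_const, probReal_univ, one_smul] at h1
  linarith

/-- Doob's maximal inequality for the submartingale F² at a finite horizon; the bound does not
depend on the horizon, which then tends to infinity. -/
theorem measure_exists_le (hX : IsBSTChain P X) {ι : Type*} {F : BinTree → ℝ} {s : Finset ι}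
    {w : ι → Node} (hF : BinTree.Compensated F s w) (h0 : F BinTree.root = 0) {ε : ℝ}
    (hε : 0 < ε) :
    P {ω | ∃ n, ε ≤ |F (X (n + 1) ω)|} ≤
      ENNReal.ofReal (BinTree.energy s w BinTree.root / ε ^ 2) := by
  have hsub := hX.submartingale hF.harmonic.sq_le_stepMean
  set A : ℕ → Set Ω := fun n => {ω | ∃ k ≤ n, ε ≤ |F (X (k + 1) ω)|} with hA
  have hU : {ω | ∃ n, ε ≤ |F (X (n + 1) ω)|} = ⋃ n, A n := by
    ext ω
    simp only [hA, Set.mem_ofPred_eq, Set.mem_iUnion]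
    exact ⟨fun ⟨n, h⟩ => ⟨n, n, le_rfl, h⟩, fun ⟨_, k, _, h⟩ => ⟨k, h⟩⟩
  have hmono : Monotone A := fun m n hmn ω ⟨k, hk, h⟩ => ⟨k, hk.trans hmn, h⟩
  rw [hU, hmono.measure_iUnion]
  refine iSup_le fun n => ?_
  have hmax := maximal_ineq hsub (fun _ _ => sq_nonneg _) (ε := (ε ^ 2).toNNReal) n
  rw [Real.coe_toNNReal _ (sq_nonneg ε)] at hmax
  have hset : {ω | ε ^ 2 ≤ (Finset.range (n + 1)).sup' Finset.nonempty_range_add_one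
      fun k => F (X (k + 1) ω) ^ 2} = A n := by
    ext ω
    simp only [hA, Set.mem_ofPred_eq, Finset.le_sup'_iff, Finset.mem_range]
    constructor
    · rintro ⟨k, hk, h⟩
      exact ⟨k, by omega, abs_of_pos hε ▸ sq_le_sq.1 h⟩
    · rintro ⟨k, hk, h⟩
      exact ⟨k, by omega, sq_le_sq.2 (by rwa [abs_of_pos hε])⟩
  rw [hset] at hmax
  rw [ENNReal.ofReal_div_of_pos (by positivity), ENNReal.le_div_iff_mul_le
    (Or.inl (by simpa using hε.ne')) (Or.inl ENNReal.ofReal_ne_top), mul_comm]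
  refine hmax.trans (ENNReal.ofReal_le_ofReal ?_)
  exact (setIntegral_le_integral (hX.integrable_comp (fun x => F x ^ 2) n)
    (Eventually.of_forall fun _ => sq_nonneg _)).trans (hX.integral_sq_le hF h0 n)

end IsBSTChain

/-! ### Almost sure properties of the martingales -/

theorem Node.exists_ofFn_eq {w : Node} {k : ℕ} (h : w.length = k) :
    ∃ f : Fin k → Bool, List.ofFn f = w := by
  subst h
  exact ⟨w.get, List.ofFn_get w⟩

/-- A sequence of trees along which the defects converge, with geometric bounds on the levels. -/
structure GoodPath (x : ℕ → BinTree) : Prop where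
  card : ∀ n, (x n).nodes.card = n + 1
  tendsto_mass : ∀ w, ∃ c, Tendsto (fun n => BinTree.massDefect w (x n)) atTop (𝓝 c)
  tendsto_fringe : ∀ w, ∃ c, Tendsto (fun n => BinTree.fringeDefect w (x n)) atTop (𝓝 c)
  mass_le : ∀ᶠ k in atTop, ∀ w : Node, w.length = k → ∀ n,
    |BinTree.massDefect w (x n)| ≤ (3 / 4 : ℝ) ^ k
  fringe_le : ∀ᶠ k in atTop, ∀ w : Node, w.length = k → ∀ n,
    |BinTree.fringeDefect w (x n)| ≤ (3 / 4 : ℝ) ^ k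
  sum_fringe_le : ∀ u : Node, ∀ᶠ k in atTop, ∀ n,
    |∑ f : Fin k → Bool, BinTree.fringeDefect (u ++ List.ofFn f) (x n)| ≤ (3 / 4 : ℝ) ^ k

theorem BinTree.compensated_fringeDefect (w : Node) :
    Compensated (fringeDefect w) (Finset.univ : Finset Unit) (fun _ => w) := by
  have h := compensated_sum_fringeDefect (Finset.univ : Finset Unit) (fun _ => w) w.length
    (Function.injective_of_subsingleton _) (fun _ => rfl)
  simpa using h

theorem summable_linear_mul_geometric (c a : ℝ) :
    Summable (fun k : ℕ => c * (a + k) * (8 / 9 : ℝ) ^ k) := by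
  have h1 := summable_pow_mul_geometric_of_norm_lt_one 1 (r := (8 / 9 : ℝ)) (by norm_num)
  have h2 := summable_geometric_of_lt_one (r := (8 / 9 : ℝ)) (by norm_num) (by norm_num)
  refine ((h2.mul_left (c * a)).add (h1.mul_left c)).congr fun k => ?_
  ring

theorem ae_eventually_notMem_of_le_geometric {Ω : Type*} [MeasurableSpace Ω] {P : Measure Ω}
    {A : ℕ → Set Ω} (c a : ℝ) (hc : 0 ≤ c) (ha : 0 ≤ a)
    (h : ∀ k, P (A k) ≤ ENNReal.ofReal (c * (a + k) * (8 / 9 : ℝ) ^ k)) :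
    ∀ᵐ ω ∂P, ∀ᶠ k in atTop, ω ∉ A k := by
  refine ae_eventually_notMem (ne_top_of_le_ne_top ?_ (ENNReal.tsum_le_tsum h))
  rw [← ENNReal.ofReal_tsum_of_nonneg (fun k => by positivity) (summable_linear_mul_geometric c a)]
  exact ENNReal.ofReal_ne_top

namespace IsBSTChain

variable {Ω : Type*} [MeasurableSpace Ω] {P : Measure Ω} [IsProbabilityMeasure P]
  {X : ℕ → Ω → BinTree}

/-- Each of the 2^k words exceeds r^k with probability at most 2(2 + k) 4^{-k} r^{-2k}. The union
bound is summable for r > 1/√2, and r = 3/4 < 1 gives the ratio 1/(2r²) = 8/9 and a summable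
threshold. -/
theorem ae_eventually_level_le (hX : IsBSTChain P X) {D : Node → BinTree → ℝ}
    (hD : ∀ w, BinTree.Compensated (D w) (Finset.univ : Finset Unit) (fun _ => w))
    (h0 : ∀ w, D w BinTree.root = 0) :
    ∀ᵐ ω ∂P, ∀ᶠ k in atTop, ∀ w : Node, w.length = k → ∀ n,
      |D w (X (n + 1) ω)| ≤ (3 / 4 : ℝ) ^ k := by
  have h := ae_eventually_notMem_of_le_geometric (P := P)
    (A := fun k => ⋃ f : Fin k → Bool,
      {ω | ∃ n, (3 / 4 : ℝ) ^ k ≤ |D (List.ofFn f) (X (n + 1) ω)|}) 2 2 (by norm_num)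
    (by norm_num) fun k => ?_
  · filter_upwards [h] with ω hω
    filter_upwards [hω] with k hk w hw n
    obtain ⟨f, rfl⟩ := Node.exists_ofFn_eq hw
    by_contra hc
    exact hk (Set.mem_iUnion.2 ⟨f, n, (not_le.1 hc).le⟩)
  · have hE : ∀ f : Fin k → Bool,
        P {ω | ∃ n, (3 / 4 : ℝ) ^ k ≤ |D (List.ofFn f) (X (n + 1) ω)|} ≤
          ENNReal.ofReal (2 * ((2 + k) * (4 : ℝ)⁻¹ ^ k) / ((3 / 4 : ℝ) ^ k) ^ 2) := by
      intro f
      refine (hX.measure_exists_le (hD _) (h0 _) (by positivity)).trans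
        (ENNReal.ofReal_le_ofReal ?_)
      gcongr
      simpa using BinTree.energy_root_le (Finset.univ : Finset Unit) (fun _ => List.ofFn f)
    refine (measure_iUnion_fintype_le _ _).trans ((Finset.sum_le_sum fun f _ => hE f).trans ?_)
    rw [Finset.sum_const, nsmul_eq_mul, ← ENNReal.ofReal_natCast,
      ← ENNReal.ofReal_mul (by positivity)]
    refine ENNReal.ofReal_le_ofReal (le_of_eq ?_)
    have : (8 / 9 : ℝ) ^ k * ((3 / 4 : ℝ) ^ k) ^ 2 = 2 ^ k * (4 : ℝ)⁻¹ ^ k := by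
      rw [← pow_mul, mul_comm k 2, pow_mul, ← mul_pow, ← mul_pow]
      norm_num
    simp only [Finset.card_univ, Fintype.card_pi, Fintype.card_bool, Finset.prod_const,
      Fintype.card_fin, Nat.cast_pow, Nat.cast_ofNat]
    rw [mul_div_assoc', div_eq_iff (by positivity)]
    linear_combination (-2 * (2 + (k : ℝ))) * this

/-- The energies of the 2^k words add up to the same order k 2^{-k} that the union bound produces
for single words, so the constants 3/4 and 8/9 serve again. -/
theorem ae_eventually_sum_fringe_le (hX : IsBSTChain P X) (u : Node) :
    ∀ᵐ ω ∂P, ∀ᶠ k in atTop, ∀ n,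
      |∑ f : Fin k → Bool, BinTree.fringeDefect (u ++ List.ofFn f) (X (n + 1) ω)| ≤
        (3 / 4 : ℝ) ^ k := by
  have h := ae_eventually_notMem_of_le_geometric (P := P)
    (A := fun k => {ω | ∃ n, (3 / 4 : ℝ) ^ k ≤
      |∑ f : Fin k → Bool, BinTree.fringeDefect (u ++ List.ofFn f) (X (n + 1) ω)|})
    (2 * (4 : ℝ)⁻¹ ^ u.length) (2 + u.length) (by positivity) (by positivity) fun k => ?_
  · filter_upwards [h] with ω hω
    filter_upwards [hω] with k hk n
    by_contra hc
    exact hk ⟨n, (not_le.1 hc).le⟩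
  · refine (hX.measure_exists_le (BinTree.compensated_sum_fringeDefect
      (Finset.univ : Finset (Fin k → Bool)) (fun f => u ++ List.ofFn f) (u.length + k) ?_ ?_)
      ?_ (by positivity)).trans (ENNReal.ofReal_le_ofReal ?_)
    · intro f g hfg
      exact List.ofFn_injective (List.append_cancel_left hfg)
    · simp
    · exact Finset.sum_eq_zero fun f _ => BinTree.fringeDefect_root _
    · rw [div_le_iff₀ (by positivity)]
      refine (BinTree.energy_root_le _ _).trans (le_of_eq ?_)
      have : (8 / 9 : ℝ) ^ k * ((3 / 4 : ℝ) ^ k) ^ 2 = 2 ^ k * (4 : ℝ)⁻¹ ^ k := by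
        rw [← pow_mul, mul_comm k 2, pow_mul, ← mul_pow, ← mul_pow]
        norm_num
      simp only [List.length_append, List.length_ofFn, Finset.sum_const, Finset.card_univ,
        Fintype.card_pi, Fintype.card_bool, Finset.prod_const, Fintype.card_fin, nsmul_eq_mul,
        Nat.cast_pow, Nat.cast_ofNat, pow_add, Nat.cast_add]
      linear_combination (-2 * (4 : ℝ)⁻¹ ^ u.length * (2 + (u.length : ℝ) + k)) * this

theorem ae_goodPath (hX : IsBSTChain P X) : ∀ᵐ ω ∂P, GoodPath (fun n => X (n + 1) ω) := by
  filter_upwards [hX.ae_card,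
    ae_all_iff.2 fun w => hX.ae_tendsto (BinTree.compensated_massDefect w)
      (BinTree.massDefect_root w),
    ae_all_iff.2 fun w => hX.ae_tendsto (BinTree.compensated_fringeDefect w)
      (BinTree.fringeDefect_root w),
    hX.ae_eventually_level_le BinTree.compensated_massDefect BinTree.massDefect_root,
    hX.ae_eventually_level_le BinTree.compensated_fringeDefect BinTree.fringeDefect_root,
    ae_all_iff.2 hX.ae_eventually_sum_fringe_le] with ω h1 h2 h3 h4 h5 h6
  exact ⟨h1, h2, h3, h4, h5, h6⟩

end IsBSTChain

/-! ### Cylinder sets -/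

theorem Ends.pre_succ (v : Ends) (k : ℕ) : v.pre (k + 1) = v.pre k ++ [v k] := by
  rw [Ends.pre, List.ofFn_succ', List.concat_eq_append]
  rfl

theorem Ends.pre_prefix (v : Ends) {k n : ℕ} (h : k ≤ n) : v.pre k <+: v.pre n := by
  induction n, h using Nat.le_induction with
  | base => exact List.prefix_rfl
  | succ n _ ih =>
    rw [Ends.pre_succ]
    exact ih.trans (List.prefix_append _ _)

namespace Node

theorem mem_cyl {u : Node} {v : Ends} : v ∈ u.cyl ↔ v.pre u.length = u := Iff.rfl

theorem prefix_of_mem_cyl {z w : Node} {v : Ends} (hz : v ∈ z.cyl) (hw : v ∈ w.cyl)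
    (h : z.length ≤ w.length) : z <+: w := by
  rw [mem_cyl] at hz hw
  rw [← hz, ← hw]
  simpa [Ends.length_pre] using v.pre_prefix h

theorem cyl_subset {z w : Node} (h : z <+: w) : w.cyl ⊆ z.cyl := by
  intro v hv
  rw [mem_cyl] at hv ⊢
  have h1 : v.pre z.length <+: w := by
    conv_rhs => rw [← hv]
    exact v.pre_prefix h.length_le
  exact (List.prefix_of_prefix_length_le h1 h (by rw [Ends.length_pre])).eq_of_length
    (Ends.length_pre _ _)

theorem isClopen_cyl (u : Node) : IsClopen u.cyl := Ends.isClopen_pre u.length {u}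

theorem measurableSet_cyl (u : Node) : MeasurableSet u.cyl := u.isClopen_cyl.isOpen.measurableSet

theorem mem_cyl_child {u : Node} {b : Bool} {v : Ends} :
    v ∈ Node.cyl (u ++ [b]) ↔ v ∈ u.cyl ∧ v u.length = b := by
  rw [mem_cyl, mem_cyl, List.length_append, List.length_singleton, Ends.pre_succ]
  constructor
  · intro h
    have := List.append_inj' h rfl
    exact ⟨this.1, by simpa using this.2⟩
  · rintro ⟨h1, h2⟩
    rw [h1, h2]

theorem measureReal_cyl_children (ν : Measure Ends) [IsProbabilityMeasure ν] (u : Node) :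
    ν.real (Node.cyl (u ++ [false])) + ν.real (Node.cyl (u ++ [true])) = ν.real u.cyl := by
  rw [← measureReal_union]
  · congr 1
    ext v
    simp only [Set.mem_union, mem_cyl_child]
    cases v u.length <;> simp
  · refine Set.disjoint_left.2 fun v h1 h2 => ?_
    have := (mem_cyl_child.1 h1).2.symm.trans (mem_cyl_child.1 h2).2
    simp at this
  · exact measurableSet_cyl _

theorem coinMeasure_real_cyl (u : Node) : coinMeasure.real u.cyl = (2 : ℝ)⁻¹ ^ u.length := by
  simp [measureReal_def, coinMeasure_cyl]

theorem coinMeasure_real_inter (z w : Node) :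
    coinMeasure.real (z.cyl ∩ w.cyl) = overlap z w := by
  unfold overlap
  split_ifs with h1 h2
  · rw [Set.inter_eq_left.2 (cyl_subset h1), coinMeasure_real_cyl]
  · rw [Set.inter_eq_right.2 (cyl_subset h2), coinMeasure_real_cyl]
  · have : z.cyl ∩ w.cyl = ∅ := by
      refine Set.eq_empty_of_forall_notMem fun v hv => ?_
      rcases le_total z.length w.length with h | h
      · exact h2 (prefix_of_mem_cyl hv.1 hv.2 h)
      · exact h1 (prefix_of_mem_cyl hv.2 hv.1 h)
    rw [this, measureReal_empty]

theorem card_proper_prefixes_le (w : Node) (s : Finset Node)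
    (hs : ∀ z ∈ s, z <+: w ∧ z.length < w.length) : s.card ≤ w.length := by
  rw [← Finset.card_range w.length]
  refine Finset.card_le_card_of_injOn List.length (fun z hz => ?_) ?_
  · simpa using (hs z hz).2
  · intro z hz z' hz' h
    exact (List.prefix_of_prefix_length_le (hs z hz).1 (hs z' hz').1 h.le).eq_of_length h

end Node

namespace BinTree

/-! ### The boundary function integrated over cylinder sets -/

/-- The nodes of x on the path v are the prefixes of v of length less than B_x(v), and there are
B_x(v) of them. -/
theorem bdry_eq_sum (x : BinTree) (v : Ends) :
    (x.bdry v : ℝ) = ∑ z ∈ x.nodes, z.cyl.indicator (fun _ => (1 : ℝ)) v := by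
  classical
  obtain ⟨N, hN⟩ := x.exists_bound
  have hmem : ∀ k, v.pre k ∈ x.nodes ↔ k < x.bdry v := by
    intro k
    constructor
    · intro hk
      by_contra hc
      have h1 : v.pre (x.bdry v) ∉ x.nodes :=
        Nat.sInf_mem (s := {k | v.pre k ∉ x.nodes}) ⟨N, hN v⟩
      exact h1 (x.prefix_mem _ hk _ (v.pre_prefix (not_lt.1 hc)))
    · intro hk
      by_contra hc
      exact absurd (Nat.sInf_le (s := {k | v.pre k ∉ x.nodes}) hc) (not_le.2 hk)
  have h : x.nodes.filter (v ∈ ·.cyl) = (Finset.range (x.bdry v)).image v.pre := by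
    ext z
    simp only [Finset.mem_filter, Finset.mem_image, Finset.mem_range, Node.mem_cyl]
    constructor
    · rintro ⟨hz, hv⟩
      exact ⟨z.length, (hmem _).1 (by rwa [hv]), hv⟩
    · rintro ⟨k, hk, rfl⟩
      exact ⟨(hmem k).2 hk, by rw [Ends.length_pre]⟩
  have hc := congrArg Finset.card h
  rw [Finset.card_image_of_injOn, Finset.card_range] at hc
  · rw [← hc, Finset.card_filter, Nat.cast_sum]
    refine Finset.sum_congr rfl fun z _ => ?_
    simp [Set.indicator_apply]
  · intro k _ l _ hkl
    simpa [Ends.length_pre] using congrArg List.length hkl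

theorem integrable_bdry_sub (x : BinTree) (c : ℝ) :
    Integrable (fun v => (x.bdry v : ℝ) - c) coinMeasure := by
  simp only [bdry_eq_sum]
  exact (integrable_finsetSum _ fun z _ =>
    (integrable_const _).indicator z.measurableSet_cyl).sub (integrable_const _)

theorem setIntegral_cyl_bdry (x : BinTree) (w : Node) :
    ∫ v in w.cyl, ((x.bdry v : ℝ) - (harmonic x.nodes.card : ℝ)) ∂coinMeasure =
      massDefect w x := by
  simp only [bdry_eq_sum]
  rw [integral_sub (integrable_finsetSum _ fun z _ =>
    (integrable_const _).indicator z.measurableSet_cyl) (integrable_const _),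
    integral_finsetSum _ fun z _ => (integrable_const _).indicator z.measurableSet_cyl,
    setIntegral_const, Node.coinMeasure_real_cyl, smul_eq_mul, massDefect]
  congr 1
  refine Finset.sum_congr rfl fun z _ => ?_
  rw [setIntegral_indicator z.measurableSet_cyl, setIntegral_const, smul_eq_mul, mul_one,
    Set.inter_comm, Node.coinMeasure_real_inter]

/-- The contribution of the coordinate `j` to an additive set function on `{v | v ≺ u}`. -/
def precTerm (g : Node → ℝ) (u : Ends) (j : ℕ) : ℝ :=
  if u j = true then g (u.pre j ++ [false]) else 0

/-- A word v ≺ u leaves u at a unique coordinate j with u_j = 1 and v_j = 0, which splits {v ≺ u}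
into disjoint cylinders. -/
theorem hasSum_smoothBdryFun (x : BinTree) (u : Ends) :
    HasSum (precTerm (fun w => massDefect w x) u) (x.smoothBdryFun x.nodes.card u) := by
  let A : ℕ → Set Ends := fun j => {v | u j = true ∧ v ∈ Node.cyl (u.pre j ++ [false])}
  have hmem : ∀ v j, v ∈ A j ↔ u j = true ∧ (∀ i < j, v i = u i) ∧ v j = false := by
    intro v j
    simp only [A, Set.mem_ofPred_eq, Node.mem_cyl_child]
    simp only [Node.mem_cyl, Ends.length_pre, Ends.pre_eq_pre_iff]
  have hA : {v : Ends | v.Prec u} = ⋃ j, A j := by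
    ext v
    simp only [Set.mem_iUnion, hmem, Set.mem_ofPred_eq, Ends.Prec]
    exact ⟨fun ⟨l, h1, h2, h3⟩ => ⟨l, h3, h1, h2⟩, fun ⟨l, h3, h1, h2⟩ => ⟨l, h1, h2, h3⟩⟩
  have hAm : ∀ j, MeasurableSet (A j) := fun j =>
    (MeasurableSet.const (u j = true)).inter (Node.measurableSet_cyl _)
  have hAd : Pairwise (Function.onFun Disjoint A) := by
    have key : ∀ i j, i < j → Disjoint (A i) (A j) := by
      intro i j hij
      refine Set.disjoint_left.2 fun v h1 h2 => ?_
      rw [hmem] at h1 h2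
      have := h2.2.1 i hij
      rw [h1.1, h1.2.2] at this
      simp at this
    intro i j hij
    rcases lt_or_gt_of_ne hij with h | h
    · exact key i j h
    · exact (key j i h).symm
  have h := hasSum_integral_iUnion hAm hAd
    (f := fun v => (x.bdry v : ℝ) - (harmonic x.nodes.card : ℝ)) (μ := coinMeasure)
    (x.integrable_bdry_sub _).integrableOn
  rw [← hA] at h
  have hterm : precTerm (fun w => massDefect w x) u = fun j =>
      ∫ v in A j, ((x.bdry v : ℝ) - (harmonic x.nodes.card : ℝ)) ∂coinMeasure := by
    funext j
    by_cases hj : u j = true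
    · simp only [precTerm, hj, if_true, A, true_and]
      exact (setIntegral_cyl_bdry x _).symm
    · simp [precTerm, hj, A]
  rw [hterm]
  exact h

/-! ### Existence of the Doob–Martin limit -/

/-- The infinite word that continues `u` with zeros. -/
def _root_.Node.toEnds (u : Node) : Ends := fun i => u.getD i false

theorem _root_.Node.toEnds_mem_cyl (u : Node) : u.toEnds ∈ u.cyl := by
  rw [Node.mem_cyl]
  apply List.ext_getElem
  · simp [Ends.pre]
  · intro i h1 h2
    simp [Ends.pre, Node.toEnds]

/-- The uniform distribution on the nodes of `x`, continued by zeros. -/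
noncomputable def empirical (x : BinTree) : Measure Ends :=
  (x.nodes.card : ENNReal)⁻¹ • ∑ v ∈ x.nodes, Measure.dirac v.toEnds

theorem card_ne_zero (x : BinTree) : x.nodes.card ≠ 0 :=
  (Finset.card_pos.2 x.nonempty).ne'

open Classical in
theorem empirical_apply (x : BinTree) {s : Set Ends} (hs : MeasurableSet s) :
    x.empirical s =
      (x.nodes.card : ENNReal)⁻¹ * ((x.nodes.filter (·.toEnds ∈ s)).card : ENNReal) := by
  rw [empirical, Measure.smul_apply, Measure.finsetSum_apply, smul_eq_mul, Finset.card_filter,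
    Nat.cast_sum]
  congr 1
  refine Finset.sum_congr rfl fun v _ => ?_
  rw [Measure.dirac_apply' _ hs]
  simp [Set.indicator_apply]

instance (x : BinTree) : IsProbabilityMeasure x.empirical := by
  classical
  constructor
  rw [empirical_apply x MeasurableSet.univ]
  simp only [Set.mem_univ, Finset.filter_true]
  exact ENNReal.inv_mul_cancel (by exact_mod_cast x.card_ne_zero) (ENNReal.natCast_ne_top _)

/-- Besides the nodes below u, only proper prefixes of u can have their zero continuation in A_u,
and there are at most |u| of these. -/
theorem empirical_real_cyl_bounds (x : BinTree) (u : Node) :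
    ((x.fringe u).card : ℝ) / x.nodes.card ≤ x.empirical.real u.cyl ∧
      x.empirical.real u.cyl ≤
        ((x.fringe u).card : ℝ) / x.nodes.card + (u.length : ℝ) / x.nodes.card := by
  classical
  have hc : (0 : ℝ) < x.nodes.card := by exact_mod_cast Nat.pos_of_ne_zero x.card_ne_zero
  rw [measureReal_def, empirical_apply x u.measurableSet_cyl, ENNReal.toReal_mul,
    ENNReal.toReal_inv, ENNReal.toReal_natCast, ENNReal.toReal_natCast, inv_mul_eq_div, ← add_div,
    card_fringe]
  have hsub : x.below u ⊆ x.nodes.filter (·.toEnds ∈ u.cyl) := by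
    intro v hv
    obtain ⟨h1, h2⟩ := Finset.mem_filter.1 hv
    exact Finset.mem_filter.2 ⟨h1, Node.cyl_subset h2 v.toEnds_mem_cyl⟩
  constructor
  · gcongr
  · gcongr
    norm_cast
    rw [← Finset.card_sdiff_add_card_eq_card hsub, add_comm]
    gcongr
    refine Node.card_proper_prefixes_le u _ fun z hz => ?_
    simp only [below, Finset.mem_sdiff, Finset.mem_filter, not_and] at hz
    obtain ⟨⟨hz1, hz2⟩, hz3⟩ := hz
    have hlt : z.length < u.length := by
      by_contra hc
      exact hz3 hz1 (Node.prefix_of_mem_cyl hz2 z.toEnds_mem_cyl (not_lt.1 hc))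
    exact ⟨Node.prefix_of_mem_cyl z.toEnds_mem_cyl hz2 hlt.le, hlt⟩

end BinTree

/-- The probability measures on the compact boundary form a compact space, so the empirical measures
converge along an ultrafilter. Cylinders are clopen, so their masses converge along it too, and the
limits must be the given `p u`. -/
theorem exists_doobMartinConv {x : ℕ → BinTree} {p : Node → ℝ}
    (hcard : Tendsto (fun n => (x n).nodes.card) atTop atTop)
    (hp : ∀ u, Tendsto (fun n => (((x n).fringe u).card : ℝ) / ((x n).nodes.card : ℝ)) atTop
      (𝓝 (p u))) :
    ∃ ν : ProbabilityMeasure Ends, DoobMartinConv x ν := by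
  let μ : ℕ → ProbabilityMeasure Ends := fun n => ⟨(x n).empirical, inferInstance⟩
  let U : Ultrafilter (ProbabilityMeasure Ends) := (hyperfilter ℕ).map μ
  obtain ⟨ν, -, hν⟩ := isCompact_univ.ultrafilter_le_nhds U (by simp)
  refine ⟨ν, hcard, fun u => ?_⟩
  have h1 : Tendsto (fun n => (x n).empirical.real u.cyl) (hyperfilter ℕ)
      (𝓝 ((ν : Measure Ends).real u.cyl)) := by
    have := ProbabilityMeasure.tendsto_measure_of_isClopen_of_tendsto
      (μs := μ) (L := (hyperfilter ℕ : Filter ℕ)) hν u.isClopen_cyl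
    exact (NNReal.tendsto_coe.2 this)
  have hinv : Tendsto (fun n => (u.length : ℝ) / ((x n).nodes.card : ℝ)) atTop (𝓝 0) :=
    (tendsto_natCast_atTop_atTop.comp hcard).const_div_atTop _
  have h2 : Tendsto (fun n => (x n).empirical.real u.cyl) atTop (𝓝 (p u)) := by
    refine tendsto_of_tendsto_of_tendsto_of_le_of_le (hp u)
      (by simpa using (hp u).add hinv)
      (fun n => ((x n).empirical_real_cyl_bounds u).1)
      (fun n => ((x n).empirical_real_cyl_bounds u).2)
  have h3 := tendsto_nhds_unique h1 (h2.mono_left Nat.hyperfilter_le_atTop)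
  rw [h3]
  exact hp u

/-! ### Sizes of fringe subtrees along a good path -/

namespace BinTree

theorem sum_overlap_le_of_notMem {x : BinTree} {w : Node} (hw : w ∉ x.nodes) :
    ∑ z ∈ x.nodes, z.overlap w ≤ (2 : ℝ)⁻¹ ^ w.length * w.length := by
  have h : ∀ z ∈ x.nodes, z.overlap w = if z <+: w then (2 : ℝ)⁻¹ ^ w.length else 0 := by
    intro z hz
    rw [Node.overlap, if_neg fun hc => hw (x.prefix_mem z hz w hc)]
  rw [Finset.sum_congr rfl h, ← Finset.sum_filter, Finset.sum_const, nsmul_eq_mul, mul_comm]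
  gcongr
  refine Node.card_proper_prefixes_le w _ fun z hz => ?_
  obtain ⟨h1, h2⟩ := Finset.mem_filter.1 hz
  refine ⟨h2, lt_of_not_ge fun hc => hw ?_⟩
  rw [← h2.eq_of_length_le hc]
  exact h1

theorem sum_overlap_of_mem {x : BinTree} {w : Node} (hw : w ∈ x.nodes) :
    ∑ z ∈ x.nodes, z.overlap w =
      ∑ z ∈ x.below w, (2 : ℝ)⁻¹ ^ z.length + (2 : ℝ)⁻¹ ^ w.length * w.length := by
  have h : ∀ z ∈ x.nodes, z.overlap w = (if w <+: z then (2 : ℝ)⁻¹ ^ z.length else 0) +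
      if z <+: w ∧ z ≠ w then (2 : ℝ)⁻¹ ^ w.length else 0 := by
    intro z _
    unfold Node.overlap
    by_cases h1 : w <+: z
    · have : ¬ (z <+: w ∧ z ≠ w) := fun hc => hc.2 (hc.1.eq_of_length_le h1.length_le)
      simp [h1, this]
    · have : z <+: w → z ≠ w := by
        rintro - rfl
        exact h1 List.prefix_rfl
      by_cases h2 : z <+: w <;> simp [h1, h2, this]
  rw [Finset.sum_congr rfl h, Finset.sum_add_distrib, ← Finset.sum_filter, ← Finset.sum_filter,
    Finset.sum_const, nsmul_eq_mul, below, mul_comm ((2 : ℝ)⁻¹ ^ w.length)]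
  congr 3
  rw [← Finset.card_range w.length, ← Finset.card_image_of_injOn (s := Finset.range w.length)
    (f := fun k => w.take k)]
  · congr 1
    ext z
    simp only [Finset.mem_filter, Finset.mem_image, Finset.mem_range]
    constructor
    · rintro ⟨-, h2, h3⟩
      refine ⟨z.length, lt_of_not_ge fun hc => h3 (h2.eq_of_length_le hc), ?_⟩
      exact (List.prefix_iff_eq_take.1 h2).symm
    · rintro ⟨k, hk, rfl⟩
      refine ⟨x.prefix_mem w hw _ (List.take_prefix _ _), List.take_prefix _ _, fun hc => ?_⟩
      have := congrArg List.length hc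
      rw [List.length_take] at this
      omega
  · intro k hk l hl hkl
    have := congrArg List.length hkl
    simp only [List.length_take] at this
    simp only [Finset.coe_range, Set.mem_Iio] at hk hl
    omega

/-- The |w| proper prefixes of w contribute 2^{-|w|} each, and the sums over nodes below w cancel.
This links both martingales to the relative size of the subtree. -/
theorem massDefect_sub_fringeDefect {x : BinTree} {w : Node} (hw : w ∈ x.nodes) :
    massDefect w x - fringeDefect w x = (2 : ℝ)⁻¹ ^ w.length *
      (w.length + ((harmonic (x.below w).card : ℝ) - (harmonic x.nodes.card : ℝ))) := by
  rw [massDefect, fringeDefect, sum_overlap_of_mem hw]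
  ring

end BinTree

theorem harmonic_cast_mono : Monotone fun n : ℕ => (harmonic n : ℝ) := by
  refine monotone_nat_of_le_succ fun n => ?_
  rw [BinTree.harmonic_succ_cast]
  have : (0 : ℝ) ≤ ((n : ℝ) + 1)⁻¹ := by positivity
  linarith

theorem tendsto_harmonic_cast : Tendsto (fun n : ℕ => (harmonic n : ℝ)) atTop atTop := by
  have h := Real.tendsto_harmonic_sub_log.add_atTop
    (Real.tendsto_log_atTop.comp tendsto_natCast_atTop_atTop)
  refine h.congr fun n => ?_
  simp

/-- H(m) - log m tends to Euler's constant, which cancels in the difference once a → ∞; the latter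
holds because H(a n) stays within bounded distance of H(b n) → ∞. -/
theorem tendsto_log_sub_log {a b : ℕ → ℕ} {c : ℝ} (hb : Tendsto b atTop atTop)
    (h : Tendsto (fun n => (harmonic (a n) : ℝ) - (harmonic (b n) : ℝ)) atTop (𝓝 c)) :
    Tendsto a atTop atTop ∧
      Tendsto (fun n => Real.log (a n) - Real.log (b n)) atTop (𝓝 c) := by
  have ha : Tendsto a atTop atTop := by
    have h1 := h.add_atTop (tendsto_harmonic_cast.comp hb)
    refine tendsto_atTop.2 fun K => ?_
    filter_upwards [h1.eventually_ge_atTop (harmonic K + 1 : ℝ)] with n hn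
    by_contra hc
    have := harmonic_cast_mono (not_le.1 hc).le
    simp only [Function.comp_apply, sub_add_cancel] at hn this
    linarith
  refine ⟨ha, ?_⟩
  have h1 := (h.sub (Real.tendsto_harmonic_sub_log.comp ha)).add
    (Real.tendsto_harmonic_sub_log.comp hb)
  simp only [sub_add_cancel] at h1
  refine h1.congr fun n => ?_
  simp only [Function.comp_apply]
  ring

namespace GoodPath

variable {x : ℕ → BinTree}

/-- The limit of the integrals of the centred boundary functions over `A_w`. -/
noncomputable def _root_.massLim (x : ℕ → BinTree) (w : Node) : ℝ :=
  limUnder atTop fun n => BinTree.massDefect w (x n)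

/-- The limit of the integrals of the centred boundary functions of the subtrees at `w`. -/
noncomputable def _root_.fringeLim (x : ℕ → BinTree) (w : Node) : ℝ :=
  limUnder atTop fun n => BinTree.fringeDefect w (x n)

theorem tendsto_massLim (hx : GoodPath x) (w : Node) :
    Tendsto (fun n => BinTree.massDefect w (x n)) atTop (𝓝 (massLim x w)) :=
  tendsto_nhds_limUnder (hx.tendsto_mass w)

theorem tendsto_fringeLim (hx : GoodPath x) (w : Node) :
    Tendsto (fun n => BinTree.fringeDefect w (x n)) atTop (𝓝 (fringeLim x w)) :=
  tendsto_nhds_limUnder (hx.tendsto_fringe w)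

theorem tendsto_card (hx : GoodPath x) : Tendsto (fun n => (x n).nodes.card) atTop atTop := by
  simp only [hx.card]
  exact tendsto_add_atTop_nat 1

/-- Outside the tree, w has at most |w| overlapping nodes, so its mass defect would be at most
2^{-|w|}(|w| - H(n)), too negative for a convergent sequence. -/
theorem eventually_mem (hx : GoodPath x) (w : Node) : ∀ᶠ n in atTop, w ∈ (x n).nodes := by
  have h1 := (tendsto_harmonic_cast.comp hx.tendsto_card).const_mul_atTop
    (show (0 : ℝ) < (2 : ℝ)⁻¹ ^ w.length by positivity)
  have h2 := (hx.tendsto_massLim w).add_atTop h1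
  filter_upwards [h2.eventually_gt_atTop ((2 : ℝ)⁻¹ ^ w.length * w.length)] with n hn
  by_contra hc
  have := BinTree.sum_overlap_le_of_notMem hc
  simp only [BinTree.massDefect, Function.comp_apply] at hn
  linarith

/-- The limit of `log (#Xₙ(w) / #Xₙ)`. -/
noncomputable def _root_.logRatioLim (x : ℕ → BinTree) (w : Node) : ℝ :=
  2 ^ w.length * (massLim x w - fringeLim x w) - w.length

theorem tendsto_ratio (hx : GoodPath x) (w : Node) :
    Tendsto (fun n => (((x n).fringe w).card : ℝ) / ((x n).nodes.card : ℝ)) atTop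
      (𝓝 (Real.exp (logRatioLim x w))) := by
  have h1 : Tendsto (fun n => (harmonic ((x n).below w).card : ℝ) -
      (harmonic (x n).nodes.card : ℝ)) atTop (𝓝 (logRatioLim x w)) := by
    refine ((((hx.tendsto_massLim w).sub (hx.tendsto_fringeLim w)).const_mul
      ((2 : ℝ) ^ w.length)).sub_const (w.length : ℝ)).congr' ?_
    filter_upwards [hx.eventually_mem w] with n hn
    have h2 : (2 : ℝ) ^ w.length * (2 : ℝ)⁻¹ ^ w.length = 1 := by
      rw [← mul_pow]
      norm_num
    rw [BinTree.massDefect_sub_fringeDefect hn, ← mul_assoc, h2]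
    ring
  obtain ⟨h2, h3⟩ := tendsto_log_sub_log hx.tendsto_card h1
  refine ((Real.continuous_exp.tendsto _).comp h3).congr' ?_
  filter_upwards [h2.eventually_gt_atTop 0] with n hn
  have h4 : (0 : ℝ) < (x n).nodes.card := by
    exact_mod_cast Nat.pos_of_ne_zero (x n).card_ne_zero
  have h5 : (0 : ℝ) < ((x n).below w).card := by exact_mod_cast hn
  rw [Function.comp_apply, Real.exp_sub, Real.exp_log h4, Real.exp_log h5, BinTree.card_fringe]

theorem exists_doobMartinConv (hx : GoodPath x) :
    ∃ ν : ProbabilityMeasure Ends, DoobMartinConv x ν :=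
  _root_.exists_doobMartinConv hx.tendsto_card hx.tendsto_ratio

variable {ν : ProbabilityMeasure Ends}

theorem measure_cyl (hx : GoodPath x) (hν : DoobMartinConv x ν) (w : Node) :
    (ν : Measure Ends).real w.cyl = Real.exp (logRatioLim x w) :=
  tendsto_nhds_unique (hν.2 w) (hx.tendsto_ratio w)

theorem measure_cyl_pos (hx : GoodPath x) (hν : DoobMartinConv x ν) (w : Node) :
    0 < (ν : Measure Ends).real w.cyl := by
  rw [hx.measure_cyl hν]
  exact Real.exp_pos _

/-! ### Identification of the limit functions -/

theorem massLim_eq (hx : GoodPath x) (hν : DoobMartinConv x ν) (w : Node) :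
    massLim x w = fringeLim x w + (2 : ℝ)⁻¹ ^ w.length *
      (w.length + Real.log ((ν : Measure Ends).real w.cyl)) := by
  have h2 : (2 : ℝ)⁻¹ ^ w.length * (2 : ℝ) ^ w.length = 1 := by
    rw [← mul_pow]
    norm_num
  rw [hx.measure_cyl hν, Real.log_exp, logRatioLim]
  linear_combination (-(massLim x w - fringeLim x w)) * h2

theorem massLim_children (hx : GoodPath x) (w : Node) :
    massLim x (w ++ [false]) + massLim x (w ++ [true]) = massLim x w := by
  refine tendsto_nhds_unique ((hx.tendsto_massLim _).add (hx.tendsto_massLim _)) ?_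
  simp only [BinTree.massDefect_children]
  exact hx.tendsto_massLim w

/-- Insert `massLim_eq` into the additivity of `massLim`. The lengths of the children yield the
constant 1 in C, and the logarithms combine into log ξ_w and log(1 - ξ_w). -/
theorem costC_splitRatio (hx : GoodPath x) (hν : DoobMartinConv x ν) (w : Node) :
    (2 : ℝ)⁻¹ ^ w.length * costC (splitRatio ν w) =
      fringeLim x w - (fringeLim x (w ++ [false]) + fringeLim x (w ++ [true])) := by
  have h := hx.massLim_children w
  rw [hx.massLim_eq hν w, hx.massLim_eq hν (w ++ [false]), hx.massLim_eq hν (w ++ [true])] at h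
  have hp := hx.measure_cyl_pos hν w
  have hp0 := hx.measure_cyl_pos hν (w ++ [false])
  have hp1 := hx.measure_cyl_pos hν (w ++ [true])
  have hs := Node.measureReal_cyl_children (ν : Measure Ends) w
  have h1 : 1 - splitRatio ν w = (ν : Measure Ends).real (Node.cyl (w ++ [true])) /
      (ν : Measure Ends).real (Node.cyl w) := by
    rw [splitRatio, ← hs]
    rw [← hs] at hp
    field_simp
    ring
  rw [costC, h1, splitRatio, Real.log_div hp0.ne' hp.ne', Real.log_div hp1.ne' hp.ne']
  simp only [List.length_append, List.length_singleton, pow_succ, Nat.cast_add, Nat.cast_one] at h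
  linear_combination h

theorem _root_.sum_level_succ (g : Node → ℝ) (u : Node) (k : ℕ) :
    ∑ f : Fin (k + 1) → Bool, g (u ++ List.ofFn f) =
      ∑ f : Fin k → Bool, (g (u ++ List.ofFn f ++ [false]) + g (u ++ List.ofFn f ++ [true])) := by
  rw [← (Fin.snocEquiv fun _ : Fin (k + 1) => Bool).sum_comp, Fintype.sum_prod_type_right]
  refine Finset.sum_congr rfl fun f _ => ?_
  have h : ∀ b, List.ofFn ((Fin.snocEquiv fun _ : Fin (k + 1) => Bool) (b, f)) =
      List.ofFn f ++ [b] := by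
    intro b
    rw [List.ofFn_succ', List.concat_eq_append]
    simp [Fin.snocEquiv]
  simp only [h, Fintype.sum_bool, List.append_assoc]
  exact add_comm _ _

theorem partialL_eq (hx : GoodPath x) (hν : DoobMartinConv x ν) (u : Node) (k : ℕ) :
    partialL ν u k = fringeLim x u - ∑ f : Fin k → Bool, fringeLim x (u ++ List.ofFn f) := by
  induction k with
  | zero => simp [partialL]
  | succ k ih =>
    rw [partialL, Finset.sum_range_succ, ← partialL, ih, sum_level_succ]
    have h : ∀ f : Fin k → Bool,
        (2 : ℝ)⁻¹ ^ (u.length + k) * costC (splitRatio ν (u ++ List.ofFn f)) =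
          fringeLim x (u ++ List.ofFn f) - (fringeLim x (u ++ List.ofFn f ++ [false]) +
            fringeLim x (u ++ List.ofFn f ++ [true])) := by
      intro f
      rw [← hx.costC_splitRatio hν]
      simp
    rw [Finset.sum_congr rfl fun f _ => h f, Finset.sum_sub_distrib]
    ring

/-- The partial sums telescope over the levels, and the remaining level sum inherits the bound
(3/4)^k from the level sums at finite times. -/
theorem tendsto_partialL (hx : GoodPath x) (hν : DoobMartinConv x ν) (u : Node) :
    Tendsto (partialL ν u) atTop (𝓝 (fringeLim x u)) := by
  have h1 : Tendsto (fun k => ∑ f : Fin k → Bool, fringeLim x (u ++ List.ofFn f)) atTop (𝓝 0) := by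
    refine squeeze_zero_norm' ?_ (tendsto_pow_atTop_nhds_zero_of_lt_one
      (r := (3 / 4 : ℝ)) (by norm_num) (by norm_num))
    filter_upwards [hx.sum_fringe_le u] with k hk
    exact le_of_tendsto' (tendsto_finsetSum _ fun f _ => hx.tendsto_fringeLim _).norm hk
  have h2 := h1.const_sub (fringeLim x u)
  rw [sub_zero] at h2
  exact h2.congr fun k => (hx.partialL_eq hν u k).symm

theorem limitL_eq (hx : GoodPath x) (hν : DoobMartinConv x ν) (u : Node) :
    limitL ν u = fringeLim x u :=
  (hx.tendsto_partialL hν u).limUnder_eq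

end GoodPath

/-! ### Uniform convergence -/

/-- Below the level from which the geometric bound holds there are only finitely many words, and
each convergent sequence is bounded. -/
theorem exists_summable_level_bound {D : Node → ℕ → ℝ}
    (hD : ∀ w, ∃ c, Tendsto (D w) atTop (𝓝 c))
    (hb : ∀ᶠ k in atTop, ∀ w : Node, w.length = k → ∀ n, |D w n| ≤ (3 / 4 : ℝ) ^ k) :
    ∃ b : ℕ → ℝ, Summable b ∧ ∀ w n, |D w n| ≤ b w.length := by
  have h1 : ∀ w, ∃ C, ∀ n, |D w n| ≤ C := by
    intro w
    obtain ⟨c, hc⟩ := hD w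
    obtain ⟨C, hC⟩ := hc.abs.bddAbove_range
    exact ⟨C, fun n => hC ⟨n, rfl⟩⟩
  choose C hC using h1
  obtain ⟨K, hK⟩ := eventually_atTop.1 hb
  refine ⟨fun k => (if k < K then ∑ f : Fin k → Bool, |C (List.ofFn f)| else 0) + (3 / 4 : ℝ) ^ k,
    Summable.add ?_ (summable_geometric_of_lt_one (by norm_num) (by norm_num)), fun w n => ?_⟩
  · refine summable_of_hasFiniteSupport ((Set.finite_lt_nat K).subset fun k hk => ?_)
    by_contra hc
    exact hk (if_neg hc)
  · have hpos : (0 : ℝ) ≤ (3 / 4 : ℝ) ^ w.length := by positivity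
    rcases lt_or_ge w.length K with h | h
    · simp only [h, if_true]
      obtain ⟨f, hf⟩ := Node.exists_ofFn_eq (w := w) rfl
      have h2 := Finset.single_le_sum (f := fun f : Fin w.length → Bool => |C (List.ofFn f)|)
        (fun _ _ => abs_nonneg _) (Finset.mem_univ f)
      simp only [hf] at h2
      linarith [hC w n, le_abs_self (C w)]
    · simp only [not_lt.2 h, if_false, zero_add]
      exact hK _ h w rfl n

namespace BinTree

theorem abs_precTerm_le {g : Node → ℝ} {b : ℕ → ℝ} (h : ∀ w, |g w| ≤ b w.length) (u : Ends)
    (j : ℕ) : |precTerm g u j| ≤ b (j + 1) := by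
  have h1 := h (u.pre j ++ [false])
  rw [List.length_append, Ends.length_pre, List.length_singleton] at h1
  unfold precTerm
  split_ifs
  · exact h1
  · rw [abs_zero]
    exact (abs_nonneg _).trans h1

theorem continuous_precTerm (g : Node → ℝ) (j : ℕ) : Continuous fun u => precTerm g u j := by
  have h1 : Continuous (fun u : Ends => fun i : Fin (j + 1) => u i) := by fun_prop
  exact (continuous_of_discreteTopology (f := fun f : Fin (j + 1) → Bool =>
    if f (Fin.last j) = true then g (List.ofFn (fun i : Fin j => f i.castSucc) ++ [false])
    else 0)).comp h1

theorem summable_precTerm {g : Node → ℝ} {b : ℕ → ℝ} (hb : Summable b)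
    (h : ∀ w, |g w| ≤ b w.length) (u : Ends) : Summable (precTerm g u) :=
  Summable.of_norm_bounded ((summable_nat_add_iff 1).2 hb) (abs_precTerm_le h u)

theorem continuous_tsum_precTerm {g : Node → ℝ} {b : ℕ → ℝ} (hb : Summable b)
    (h : ∀ w, |g w| ≤ b w.length) : Continuous fun u => ∑' j, precTerm g u j :=
  continuous_tsum (continuous_precTerm g) ((summable_nat_add_iff 1).2 hb)
    fun j u => abs_precTerm_le h u j

/-- The maximum of `|g|` over the words of length `k`. -/
noncomputable def levelSup (g : Node → ℝ) (k : ℕ) : ℝ :=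
  ⨆ f : Fin k → Bool, |g (List.ofFn f)|

theorem le_levelSup (g : Node → ℝ) (w : Node) : |g w| ≤ levelSup g w.length := by
  obtain ⟨f, hf⟩ := Node.exists_ofFn_eq (w := w) rfl
  have h : |g (List.ofFn f)| ≤ levelSup g w.length :=
    le_ciSup (f := fun f : Fin w.length → Bool => |g (List.ofFn f)|)
      (Set.finite_range _).bddAbove f
  rwa [hf] at h

theorem levelSup_nonneg (g : Node → ℝ) (k : ℕ) : 0 ≤ levelSup g k :=
  Real.iSup_nonneg fun _ => abs_nonneg _

theorem levelSup_le {g : Node → ℝ} {k : ℕ} {c : ℝ} (h : ∀ w : Node, w.length = k → |g w| ≤ c) :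
    levelSup g k ≤ c :=
  ciSup_le fun f => h _ (by simp)

theorem tendsto_levelSup {g : ℕ → Node → ℝ} (h : ∀ w, Tendsto (fun n => g n w) atTop (𝓝 0))
    (k : ℕ) : Tendsto (fun n => levelSup (g n) k) atTop (𝓝 0) := by
  have h1 : Tendsto (fun n => ∑ f : Fin k → Bool, |g n (List.ofFn f)|) atTop (𝓝 0) := by
    simpa using tendsto_finsetSum (Finset.univ : Finset (Fin k → Bool))
      fun f _ => (h (List.ofFn f)).abs
  refine squeeze_zero (fun n => levelSup_nonneg _ _) (fun n => ciSup_le fun f => ?_) h1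
  exact Finset.single_le_sum (f := fun f : Fin k → Bool => |g n (List.ofFn f)|)
    (fun _ _ => abs_nonneg _) (Finset.mem_univ f)

end BinTree

open BinTree

namespace GoodPath

variable {x : ℕ → BinTree} {ν : ProbabilityMeasure Ends}

theorem exists_mass_bound (hx : GoodPath x) : ∃ b : ℕ → ℝ, Summable b ∧
    (∀ w n, |massDefect w (x n)| ≤ b w.length) ∧ ∀ w, |massLim x w| ≤ b w.length := by
  obtain ⟨b, h1, h2⟩ := exists_summable_level_bound hx.tendsto_mass hx.mass_le
  exact ⟨b, h1, h2, fun w => le_of_tendsto' (hx.tendsto_massLim w).abs (h2 w)⟩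

theorem exists_fringe_bound (hx : GoodPath x) : ∃ b : ℕ → ℝ, Summable b ∧
    ∀ w, |fringeLim x w| ≤ b w.length := by
  obtain ⟨b, h1, h2⟩ := exists_summable_level_bound hx.tendsto_fringe hx.fringe_le
  exact ⟨b, h1, fun w => le_of_tendsto' (hx.tendsto_fringeLim w).abs (h2 w)⟩

theorem termY'_eq (hx : GoodPath x) (hν : DoobMartinConv x ν) (u : Ends) :
    termY' ν u = precTerm (fringeLim x) u := by
  funext j
  rw [termY', precTerm, hx.limitL_eq hν]

theorem termY''_eq (hx : GoodPath x) (hν : DoobMartinConv x ν) (u : Ends) :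
    termY'' ν u = precTerm (fun w => massLim x w - fringeLim x w) u := by
  funext j
  rw [termY'', precTerm, hx.massLim_eq hν, add_sub_cancel_left, List.length_append,
    Ends.length_pre, List.length_singleton]

theorem limit_properties (hx : GoodPath x) (hν : DoobMartinConv x ν) :
    (∀ u : Ends, Summable (termY' ν u)) ∧ (∀ u : Ends, Summable (termY'' ν u)) ∧
      Continuous (limitY' ν) ∧ Continuous (limitY'' ν) ∧
      ∀ u : Ends, limitY' ν u + limitY'' ν u = ∑' j, precTerm (massLim x) u j := by
  obtain ⟨b, hb, -, hbM⟩ := hx.exists_mass_bound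
  obtain ⟨c, hc, hcL⟩ := hx.exists_fringe_bound
  have hd : ∀ w, |massLim x w - fringeLim x w| ≤ (fun k => b k + c k) w.length := fun w =>
    (abs_sub _ _).trans (add_le_add (hbM w) (hcL w))
  have h1 : ∀ u : Ends, Summable (termY' ν u) := fun u => by
    rw [hx.termY'_eq hν]
    exact summable_precTerm hc hcL u
  have h2 : ∀ u : Ends, Summable (termY'' ν u) := fun u => by
    rw [hx.termY''_eq hν]
    exact summable_precTerm (hb.add hc) hd u
  refine ⟨h1, h2, ?_, ?_, fun u => ?_⟩
  · unfold limitY'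
    simp only [hx.termY'_eq hν]
    exact continuous_tsum_precTerm hc hcL
  · unfold limitY''
    simp only [hx.termY''_eq hν]
    exact continuous_tsum_precTerm (hb.add hc) hd
  · rw [limitY', limitY'', ← (h1 u).tsum_add (h2 u)]
    refine tsum_congr fun j => ?_
    rw [hx.termY'_eq hν, hx.termY''_eq hν]
    unfold precTerm
    split_ifs <;> ring

/-- For every u the error is at most the sum over levels of the largest error at that level. Each
level has finitely many words, so its term tends to 0, and all terms have a summable bound
independent of n. -/
theorem exists_tendsto_smoothBdry (hx : GoodPath x) (hν : DoobMartinConv x ν) :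
    ∃ Y : C(Ends, ℝ), (∀ u, Y u = limitY' ν u + limitY'' ν u) ∧
      Tendsto (fun n => (x n).smoothBdry (n + 1)) atTop (𝓝 Y) := by
  obtain ⟨b, hb, hbn, hbM⟩ := hx.exists_mass_bound
  refine ⟨⟨fun u => ∑' j, precTerm (massLim x) u j, continuous_tsum_precTerm hb hbM⟩,
    fun u => ((hx.limit_properties hν).2.2.2.2 u).symm, ?_⟩
  set g : ℕ → Node → ℝ := fun n w => massDefect w (x n) - massLim x w with hg
  have hg2 : ∀ n w, |g n w| ≤ 2 * b w.length := fun n w => by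
    refine (abs_sub _ _).trans ?_
    linarith [hbn w n, hbM w]
  have hlev : ∀ n k, levelSup (g n) k ≤ 2 * b k := fun n k =>
    levelSup_le fun w hw => hw ▸ hg2 n w
  have hsum : ∀ n, Summable (levelSup (g n)) := fun n =>
    Summable.of_nonneg_of_le (levelSup_nonneg _) (hlev n) (hb.mul_left 2)
  have hlim : Tendsto (fun n => ∑' k, levelSup (g n) (k + 1)) atTop (𝓝 0) := by
    have h := tendsto_tsum_of_dominated_convergence (𝓕 := atTop)
      (f := fun n k => levelSup (g n) (k + 1)) (g := fun _ => (0 : ℝ))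
      (bound := fun k => 2 * b (k + 1)) ((summable_nat_add_iff 1).2 (hb.mul_left 2))
      (fun k => tendsto_levelSup (fun w => by
        simpa only [hg, sub_self] using (hx.tendsto_massLim w).sub_const (massLim x w)) (k + 1))
      (Eventually.of_forall fun n k => by
        rw [Real.norm_of_nonneg (levelSup_nonneg _ _)]
        exact hlev n (k + 1))
    simpa using h
  rw [tendsto_iff_norm_sub_tendsto_zero]
  refine squeeze_zero (fun _ => norm_nonneg _) (fun n => ?_) hlim
  refine (ContinuousMap.norm_le _ (tsum_nonneg fun k => levelSup_nonneg _ _)).2 fun u => ?_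
  have h1 := (x n).hasSum_smoothBdryFun u
  rw [hx.card n] at h1
  have h2 : HasSum (precTerm (g n) u)
      ((x n).smoothBdryFun (n + 1) u - ∑' j, precTerm (massLim x) u j) := by
    refine (h1.sub (summable_precTerm hb hbM u).hasSum).congr_fun fun j => ?_
    unfold precTerm
    split_ifs <;> simp [hg]
  change |(x n).smoothBdryFun (n + 1) u - ∑' j, precTerm (massLim x) u j| ≤ _
  rw [← h2.tsum_eq]
  exact tsum_of_norm_bounded (f := precTerm (g n) u) (((summable_nat_add_iff 1).2 (hsum n)).hasSum)
    (abs_precTerm_le (le_levelSup (g n)) u)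

end GoodPath

/-! ### Measurability of the limit -/

theorem Node.isPiSystem_cyl : IsPiSystem (Set.range Node.cyl) := by
  rintro _ ⟨z, rfl⟩ _ ⟨w, rfl⟩ ⟨v, hz, hw⟩
  rcases le_total z.length w.length with h | h
  · exact ⟨w, (Set.inter_eq_right.2 (cyl_subset (prefix_of_mem_cyl hz hw h))).symm⟩
  · exact ⟨z, (Set.inter_eq_left.2 (cyl_subset (prefix_of_mem_cyl hw hz h))).symm⟩

theorem Node.generateFrom_cyl :
    (inferInstance : MeasurableSpace Ends) = MeasurableSpace.generateFrom (Set.range Node.cyl) := by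
  refine le_antisymm (iSup_le fun j => ?_) (MeasurableSpace.generateFrom_le ?_)
  · rw [← measurable_iff_comap_le]
    refine @measurable_to_countable' _ _ _ _ (MeasurableSpace.generateFrom _) _ fun b => ?_
    have h : (fun v : Ends => v j) ⁻¹' {b} =
        ⋃ w : {w : Node // w.length = j}, Node.cyl (w.1 ++ [b]) := by
      ext v
      simp only [Set.mem_preimage, Set.mem_singleton_iff, Set.mem_iUnion, mem_cyl_child]
      constructor
      · intro hv
        refine ⟨⟨v.pre j, Ends.length_pre v j⟩, ?_, ?_⟩
        · rw [mem_cyl, Ends.length_pre]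
        · rw [Ends.length_pre, hv]
      · rintro ⟨⟨w, rfl⟩, -, hv⟩
        exact hv
    rw [h]
    exact MeasurableSet.iUnion fun w => MeasurableSpace.measurableSet_generateFrom ⟨_, rfl⟩
  · rintro _ ⟨u, rfl⟩
    exact u.measurableSet_cyl

theorem DoobMartinConv.succ_iff {x : ℕ → BinTree} {ν : ProbabilityMeasure Ends} :
    DoobMartinConv (fun n => x (n + 1)) ν ↔ DoobMartinConv x ν := by
  unfold DoobMartinConv
  rw [tendsto_add_atTop_iff_nat (f := fun n => (x n).nodes.card) 1]
  refine and_congr_right fun _ => forall_congr' fun u => ?_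
  exact tendsto_add_atTop_iff_nat
    (f := fun n => (((x n).fringe u).card : ℝ) / ((x n).nodes.card : ℝ)) 1

theorem doobMartinConv_limit {x : ℕ → BinTree} (h : ∃ ν, DoobMartinConv x ν) :
    DoobMartinConv x (doobMartinLimit x) := by
  have h' : doobMartinLimit x = h.choose := dif_pos h
  rw [h']
  exact h.choose_spec

theorem IsBSTChain.aemeasurable_of_doobMartinConv {Ω : Type*} [MeasurableSpace Ω] {P : Measure Ω}
    {X : ℕ → Ω → BinTree} (hX : IsBSTChain P X) {ν : Ω → ProbabilityMeasure Ends}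
    (hν : ∀ᵐ ω ∂P, DoobMartinConv (fun n => X n ω) (ν ω)) : AEMeasurable ν P := by
  classical
  -- The set of convergence need not be measurable, so its complement is enlarged to a measurable
  -- null set. Off this set the cylinder masses are limits of measurable functions, and cylinders
  -- are a generating π-system.
  set N : Set Ω := toMeasurable P {ω | DoobMartinConv (fun n => X n ω) (ν ω)}ᶜ
  have hN : MeasurableSet N := measurableSet_toMeasurable _ _
  have hN0 : P N = 0 := by
    rw [measure_toMeasurable]
    exact hν
  have hconv : ∀ ω ∉ N, DoobMartinConv (fun n => X n ω) (ν ω) := fun ω hω => by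
    by_contra hc
    exact hω (subset_toMeasurable _ _ hc)
  let c : ProbabilityMeasure Ends := ⟨coinMeasure, inferInstance⟩
  refine ⟨fun ω => if ω ∈ N then c else ν ω, ?_, ?_⟩
  · refine Measurable.subtype_mk (f := fun ω => ((if ω ∈ N then c else ν ω :
      ProbabilityMeasure Ends) : Measure Ends)) ?_
    refine Measurable.measure_of_isPiSystem_of_isProbabilityMeasure Node.generateFrom_cyl
      Node.isPiSystem_cyl ?_
    rintro _ ⟨u, rfl⟩
    have h : Measurable fun ω =>
        ((if ω ∈ N then c else ν ω : ProbabilityMeasure Ends) : Measure Ends).real u.cyl := by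
      refine measurable_of_tendsto_metrizable (f := fun n ω => if ω ∈ N then
        (c : Measure Ends).real u.cyl else
          (((X (n + 1) ω).fringe u).card : ℝ) / ((X (n + 1) ω).nodes.card : ℝ)) (fun n => ?_) ?_
      · exact Measurable.ite hN measurable_const
          (hX.measurable_comp (fun x => ((x.fringe u).card : ℝ) / (x.nodes.card : ℝ)) n)
      · rw [tendsto_pi_nhds]
        intro ω
        by_cases hω : ω ∈ N
        · simp [hω]
        · simp only [hω, if_false]
          exact ((DoobMartinConv.succ_iff (x := fun n => X n ω)).2 (hconv ω hω)).2 u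
    convert h.ennreal_ofReal with ω
    exact (ofReal_measureReal (measure_ne_top _ _)).symm
  · filter_upwards [measure_eq_zero_iff_ae_notMem.1 hN0] with ω hω
    rw [if_neg hω]

/-! ### The main theorem -/

theorem mainTheorem1 {Ω : Type*} [MeasurableSpace Ω] (P : Measure Ω) [IsProbabilityMeasure P]
    (X : ℕ → Ω → BinTree) (hX : IsBSTChain P X)
    (Xinf : Ω → ProbabilityMeasure Ends)
    (hXinf : Xinf = fun ω => doobMartinLimit (fun n => X n ω)) :
    -- the Doob–Martin limit is a random probability measure, and the chain converges to it
    AEMeasurable Xinf P ∧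
    (∀ᵐ ω ∂P, DoobMartinConv (fun n => X n ω) (Xinf ω)) ∧
    -- the limit functions are well defined and continuous
    (∀ᵐ ω ∂P,
      (∀ u : Node, 0 < (Xinf ω : Measure Ends).real u.cyl) ∧
      (∀ u : Node, Tendsto (partialL (Xinf ω) u) atTop (𝓝 (limitL (Xinf ω) u))) ∧
      (∀ u : Ends, Summable (termY' (Xinf ω) u)) ∧
      (∀ u : Ends, Summable (termY'' (Xinf ω) u)) ∧
      Continuous (limitY' (Xinf ω)) ∧ Continuous (limitY'' (Xinf ω))) ∧
    -- convergence in the supremum norm to the random continuous function `Y' + Y''`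
    ∃ Yinf : Ω → C(Ends, ℝ), StronglyMeasurable Yinf ∧
      ∀ᵐ ω ∂P,
        (∀ u : Ends, Yinf ω u = limitY' (Xinf ω) u + limitY'' (Xinf ω) u) ∧
        Tendsto (fun n => ‖(X n ω).smoothBdry n - Yinf ω‖) atTop (𝓝 0) := by
  have hgood : ∀ᵐ ω ∂P, GoodPath (fun n => X (n + 1) ω) ∧
      DoobMartinConv (fun n => X (n + 1) ω) (Xinf ω) := by
    filter_upwards [hX.ae_goodPath] with ω hω
    obtain ⟨ν, hν⟩ := hω.exists_doobMartinConv
    refine ⟨hω, (DoobMartinConv.succ_iff (x := fun n => X n ω)).2 ?_⟩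
    rw [hXinf]
    exact doobMartinConv_limit ⟨ν, (DoobMartinConv.succ_iff (x := fun n => X n ω)).1 hν⟩
  have hconv : ∀ᵐ ω ∂P, DoobMartinConv (fun n => X n ω) (Xinf ω) := by
    filter_upwards [hgood] with ω hω
    exact (DoobMartinConv.succ_iff (x := fun n => X n ω)).1 hω.2
  refine ⟨hX.aemeasurable_of_doobMartinConv hconv, hconv, ?_, ?_⟩
  · filter_upwards [hgood] with ω ⟨hx, hν⟩
    obtain ⟨h1, h2, h3, h4, -⟩ := hx.limit_properties hν
    refine ⟨hx.measure_cyl_pos hν, fun u => ?_, h1, h2, h3, h4⟩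
    rw [hx.limitL_eq hν]
    exact hx.tendsto_partialL hν u
  · have hex : ∀ᵐ ω ∂P, ∃ Y : C(Ends, ℝ),
        Tendsto (fun n => (X (n + 1) ω).smoothBdry (n + 1)) atTop (𝓝 Y) := by
      filter_upwards [hgood] with ω ⟨hx, hν⟩
      obtain ⟨Y, -, hY⟩ := hx.exists_tendsto_smoothBdry hν
      exact ⟨Y, hY⟩
    -- The space of trees is countable and discrete, so any map from it to C(∂𝕍) is strongly
    -- measurable; this makes the almost sure limit a random element of the Banach space.
    have hmeas : ∀ n, AEStronglyMeasurable (fun ω => (X (n + 1) ω).smoothBdry (n + 1)) P :=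
      fun n => ((StronglyMeasurable.of_discrete (f := fun x : BinTree =>
        x.smoothBdry (n + 1))).comp_measurable
          (hX.measurable (n + 1) (by omega))).aestronglyMeasurable
    obtain ⟨Yinf, hYm, hY⟩ := exists_stronglyMeasurable_limit_of_tendsto_ae hmeas hex
    refine ⟨Yinf, hYm, ?_⟩
    filter_upwards [hgood, hY] with ω ⟨hx, hν⟩ hYω
    obtain ⟨Y, hY1, hY2⟩ := hx.exists_tendsto_smoothBdry hν
    have hYY : Yinf ω = Y := tendsto_nhds_unique hYω hY2
    refine ⟨fun u => hYY ▸ hY1 u, ?_⟩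
    rw [tendsto_iff_norm_sub_tendsto_zero] at hYω
    -- The good path starts at X₁, so the shift by one discards the irrelevant value X₀.
    exact (tendsto_add_atTop_iff_nat (f := fun n => ‖(X n ω).smoothBdry n - Yinf ω‖) 1).1 hYω
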